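/- Let $\Delta=\{z\in\mathbb C:|z|<1\}$ and $\overline\Delta=\{z\in\mathbb C:|z|\le 1\}$. For a circle $\Gamma$ of positive radius bounding the open disc $D$, a function $f$ that is continuous on $\Gamma$ is said to extend holomorphically from $\Gamma$ if there is a continuous function on $D\cup\Gamma$ that is holomorphic on $D$ and equals $f$ on $\Gamma$. **Theorem 1.1.** Let $p\in\mathbb C$ with $|p|=1$ and let $\tau\in\mathbb R$ with $\tau<1/2$. Let $f:\overline\Delta\to\mathbb C$ be continuous, and suppose that (i) $f$ extends holomorphically from each circle $|\zeta|=R$, $0<R\le 1$; (ii) $f$ extends holomorphically from each circle of (positive) radius $R\ge\tau$ that is contained in $\overline\Delta$ and passes through $p$. Then $f$ is holomorphic on $\Delta$. In particular, if a continuous function $f:\overline\Delta\to\mathbb C$ extends holomorphically from each circle in $\overline\Delta$ centered at the origin and from each circle in $\overline\Delta$ that passes through $p$, then $f$ is holomorphic on $\Delta$. -/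

import Mathlib

/-- `f` extends holomorphically from the circle with centre `c` and radius `r` (used for `0 < r`):
there is a function continuous on the closed disc bounded by the circle and holomorphic on the
open disc that agrees with `f` on the circle. -/
def ExtendsHolomorphicallyFromCircle (f : ℂ → ℂ) (c : ℂ) (r : ℝ) : Prop :=
  ∃ g : ℂ → ℂ, ContinuousOn g (Metric.closedBall c r) ∧ DifferentiableOn ℂ g (Metric.ball c r) ∧
    Set.EqOn g f (Metric.sphere c r)

open Complex Set Metric Filter Topology MeasureTheory
open scoped Interval

/-! After a rotation `p = 1`, and `τ` may be taken positive. Subtracting the extension of `f` from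
the unit circle leaves a function `u` that vanishes on that circle; set it to zero outside the disc.
Then `u` still extends from all circles of both families, with extension zero once the radius is at
least `1`, and the claim is `u = 0`.

On `|z|² = T` one has `z * conj z = T`. On the circle of centre `1 - R` and radius `R`, `conj z`
equals a rational function of `z`, and `z * conj z = horoNum z R / horoDen z R`. For fixed `z`, both
families of extensions are thus functions on curves in the plane of the variable `T`. Integrate them
there against the form `(1/(T - t₁) - 1/(T - t₂)) dT`, starting at the circle through `z`. Each
fibre integral fails to be holomorphic only because its lower limit moves with `z`. At that limit
both integrands are `u z` times the same form, so the difference `J` of the two integrals is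
holomorphic (`differentiableOn_integral_sub_integral`, `kernel_relation`).

With `t₁`, `t₂` in one open half plane, the kernels have no poles over the half strip `0 < Re z < 1
- 2τ` on the same side of the real axis. The strip leaves the unit disc, where `J = 0`; hence `J =
0` throughout and, by continuity, at real `x` (`CirclePair.integral_eq`). Now let `t₁`, `t₂`
approach points `a₁`, `a₂` of `(x², 1)` from above and from below. The centred integral jumps by
`2πi` times the difference of the extensions at `x`. The tangent one does not jump, since its values
of `T` avoid `(x², 1)`. So the centred extension at `x` does not depend on the radius in `(x, 1)`;
radius `1` gives the value zero, and the identity theorem gives `u = 0`. -/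

/-! ### Integrals over boundaries of rectangles -/

/-- The integral of `f` along the boundary of the rectangle with opposite corners `z` and `w`. -/
noncomputable def rectInt (f : ℂ → ℂ) (z w : ℂ) : ℂ := wedgeIntegral z w f + wedgeIntegral w z f

theorem rectInt_eq (f : ℂ → ℂ) (z w : ℂ) :
    rectInt f z w = (∫ x : ℝ in z.re..w.re, f (x + z.im * I)) -
      (∫ x : ℝ in z.re..w.re, f (x + w.im * I)) +
      I * (∫ y : ℝ in z.im..w.im, f (w.re + y * I)) -
      I * (∫ y : ℝ in z.im..w.im, f (z.re + y * I)) := by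
  simpa [rectInt] using wedgeIntegral_add_wedgeIntegral_eq z w f

theorem mem_Rectangle_iff {z w ζ : ℂ} :
    ζ ∈ Rectangle z w ↔ ζ.re ∈ [[z.re, w.re]] ∧ ζ.im ∈ [[z.im, w.im]] := Iff.rfl

theorem isCompact_Rectangle (z w : ℂ) : IsCompact (Rectangle z w) :=
  isCompact_uIcc.reProdIm isCompact_uIcc

theorem dist_le_of_mem_Rectangle {z w a b : ℂ} (ha : a ∈ Rectangle z w) (hb : b ∈ Rectangle z w) :
    ‖a - b‖ ≤ ‖w - z‖ := by
  have h1 : |a.re - b.re| ≤ |w.re - z.re| := by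
    rw [abs_sub_comm w.re]
    exact abs_sub_le_of_uIcc_subset_uIcc (uIcc_subset_uIcc hb.1 ha.1) |>.trans_eq (abs_sub_comm _ _)
  have h2 : |a.im - b.im| ≤ |w.im - z.im| := by
    rw [abs_sub_comm w.im]
    exact abs_sub_le_of_uIcc_subset_uIcc (uIcc_subset_uIcc hb.2 ha.2) |>.trans_eq (abs_sub_comm _ _)
  rw [Complex.norm_eq_sqrt_sq_add_sq, Complex.norm_eq_sqrt_sq_add_sq]
  apply Real.sqrt_le_sqrt
  simpa using add_le_add (sq_le_sq.2 h1) (sq_le_sq.2 h2)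

section sides

variable {f g : ℂ → ℂ} {z w : ℂ}

theorem intervalIntegrable_horizontal (hf : ContinuousOn f (Rectangle z w)) {y a b : ℝ}
    (hy : y ∈ [[z.im, w.im]]) (ha : a ∈ [[z.re, w.re]]) (hb : b ∈ [[z.re, w.re]]) :
    IntervalIntegrable (fun x : ℝ => f (x + y * I)) volume a b := by
  apply ContinuousOn.intervalIntegrable
  apply hf.comp (by fun_prop)
  intro x hx
  simpa [mem_Rectangle_iff] using ⟨uIcc_subset_uIcc ha hb hx, hy⟩

theorem intervalIntegrable_vertical (hf : ContinuousOn f (Rectangle z w)) {x a b : ℝ}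
    (hx : x ∈ [[z.re, w.re]]) (ha : a ∈ [[z.im, w.im]]) (hb : b ∈ [[z.im, w.im]]) :
    IntervalIntegrable (fun y : ℝ => f (x + y * I)) volume a b := by
  apply ContinuousOn.intervalIntegrable
  apply hf.comp (by fun_prop)
  intro y hy
  simpa [mem_Rectangle_iff] using ⟨hx, uIcc_subset_uIcc ha hb hy⟩

theorem rectInt_sub (hf : ContinuousOn f (Rectangle z w)) (hg : ContinuousOn g (Rectangle z w)) :
    rectInt (fun ζ => f ζ - g ζ) z w = rectInt f z w - rectInt g z w := by
  simp only [rectInt_eq]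
  rw [intervalIntegral.integral_sub, intervalIntegral.integral_sub, intervalIntegral.integral_sub,
    intervalIntegral.integral_sub]
  · ring
  all_goals
    first
    | exact intervalIntegrable_horizontal ‹_› (by simp) (by simp) (by simp)
    | exact intervalIntegrable_vertical ‹_› (by simp) (by simp) (by simp)

theorem rectInt_add (hf : ContinuousOn f (Rectangle z w)) (hg : ContinuousOn g (Rectangle z w)) :
    rectInt (fun ζ => f ζ + g ζ) z w = rectInt f z w + rectInt g z w := by
  simp only [rectInt_eq]
  rw [intervalIntegral.integral_add, intervalIntegral.integral_add, intervalIntegral.integral_add,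
    intervalIntegral.integral_add]
  · ring
  all_goals
    first
    | exact intervalIntegrable_horizontal ‹_› (by simp) (by simp) (by simp)
    | exact intervalIntegrable_vertical ‹_› (by simp) (by simp) (by simp)

theorem rectInt_congr (h : EqOn f g (Rectangle z w)) : rectInt f z w = rectInt g z w := by
  have H : ∀ y ∈ [[z.im, w.im]], (∫ x : ℝ in z.re..w.re, f (x + y * I)) =
      ∫ x : ℝ in z.re..w.re, g (x + y * I) := fun y hy =>
    intervalIntegral.integral_congr fun x hx => h (by simpa [mem_Rectangle_iff] using ⟨hx, hy⟩)
  have V : ∀ x ∈ [[z.re, w.re]], (∫ y : ℝ in z.im..w.im, f (x + y * I)) =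
      ∫ y : ℝ in z.im..w.im, g (x + y * I) := fun x hx =>
    intervalIntegral.integral_congr fun y hy => h (by simpa [mem_Rectangle_iff] using ⟨hx, hy⟩)
  rw [rectInt_eq, rectInt_eq, H z.im (by simp), H w.im (by simp), V z.re (by simp),
    V w.re (by simp)]

theorem rectInt_eq_zero (hf : DifferentiableOn ℂ f (Rectangle z w)) : rectInt f z w = 0 := by
  rw [rectInt, hf.isConservativeOn z w subset_rfl, neg_add_cancel]

theorem norm_rectInt_le {M : ℝ} (hM : ∀ ζ ∈ Rectangle z w, ‖f ζ‖ ≤ M) :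
    ‖rectInt f z w‖ ≤ 4 * M * ‖w - z‖ := by
  have hM0 : 0 ≤ M := (norm_nonneg _).trans (hM z (by simp [mem_Rectangle_iff]))
  have hre : |w.re - z.re| ≤ ‖w - z‖ := by simpa using Complex.abs_re_le_norm (w - z)
  have him : |w.im - z.im| ≤ ‖w - z‖ := by simpa using Complex.abs_im_le_norm (w - z)
  have hh : ∀ y ∈ [[z.im, w.im]], ‖∫ x : ℝ in z.re..w.re, f (x + y * I)‖ ≤ M * ‖w - z‖ := by
    intro y hy
    refine (intervalIntegral.norm_integral_le_of_norm_le_const (C := M) fun x hx => hM _ ?_).trans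
      (by gcongr)
    simpa [mem_Rectangle_iff] using ⟨uIoc_subset_uIcc hx, hy⟩
  have hv : ∀ x ∈ [[z.re, w.re]], ‖∫ y : ℝ in z.im..w.im, f (x + y * I)‖ ≤ M * ‖w - z‖ := by
    intro x hx
    refine (intervalIntegral.norm_integral_le_of_norm_le_const (C := M) fun y hy => hM _ ?_).trans
      (by gcongr)
    simpa [mem_Rectangle_iff] using ⟨hx, uIoc_subset_uIcc hy⟩
  rw [rectInt_eq]
  refine (norm_sub_le _ _).trans ?_
  refine (add_le_add ((norm_add_le _ _).trans (add_le_add (norm_sub_le _ _) le_rfl)) le_rfl).trans ?_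
  have h1 := hh z.im (by simp)
  have h2 := hh w.im (by simp)
  have h3 := hv w.re (by simp)
  have h4 := hv z.re (by simp)
  simp only [norm_mul, norm_I, one_mul]
  linarith

theorem rectInt_quarter (hf : ContinuousOn f (Rectangle z w)) {m : ℂ} (hm : m ∈ Rectangle z w) :
    rectInt f z w = rectInt f z m + rectInt f ⟨m.re, z.im⟩ ⟨w.re, m.im⟩
      + rectInt f ⟨z.re, m.im⟩ ⟨m.re, w.im⟩ + rectInt f m w := by
  simp only [rectInt_eq]
  have H : ∀ y ∈ [[z.im, w.im]], (∫ x : ℝ in z.re..m.re, f (x + y * I)) +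
      (∫ x : ℝ in m.re..w.re, f (x + y * I)) = ∫ x : ℝ in z.re..w.re, f (x + y * I) := fun y hy =>
    intervalIntegral.integral_add_adjacent_intervals
      (intervalIntegrable_horizontal hf hy (by simp) hm.1)
      (intervalIntegrable_horizontal hf hy hm.1 (by simp))
  have V : ∀ x ∈ [[z.re, w.re]], (∫ y : ℝ in z.im..m.im, f (x + y * I)) +
      (∫ y : ℝ in m.im..w.im, f (x + y * I)) = ∫ y : ℝ in z.im..w.im, f (x + y * I) := fun x hx =>
    intervalIntegral.integral_add_adjacent_intervals
      (intervalIntegrable_vertical hf hx (by simp) hm.2)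
      (intervalIntegrable_vertical hf hx hm.2 (by simp))
  rw [← H z.im (by simp), ← H w.im (by simp), ← V z.re (by simp), ← V w.re (by simp)]
  ring

end sides

/-! ### Goursat subdivision -/

theorem exists_quarter {f : ℂ → ℂ} {z w : ℂ} (hf : ContinuousOn f (Rectangle z w)) :
    ∃ z' w' : ℂ, Rectangle z' w' ⊆ Rectangle z w ∧ w' - z' = (w - z) / 2 ∧
      ‖rectInt f z w‖ / 4 ≤ ‖rectInt f z' w'‖ := by
  set m : ℂ := (z + w) / 2 with hm
  have mre : m.re = (z.re + w.re) / 2 := by simp [hm]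
  have mim : m.im = (z.im + w.im) / 2 := by simp [hm]
  have h1 : m.re ∈ [[z.re, w.re]] := by
    rw [mre, mem_uIcc]; rcases le_total z.re w.re with h | h
    · left; constructor <;> linarith
    · right; constructor <;> linarith
  have h2 : m.im ∈ [[z.im, w.im]] := by
    rw [mim, mem_uIcc]; rcases le_total z.im w.im with h | h
    · left; constructor <;> linarith
    · right; constructor <;> linarith
  have key := rectInt_quarter hf (m := m) ⟨h1, h2⟩
  have sub : ∀ a b : ℂ, a.re ∈ [[z.re, w.re]] → b.re ∈ [[z.re, w.re]] → a.im ∈ [[z.im, w.im]] →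
      b.im ∈ [[z.im, w.im]] → Rectangle a b ⊆ Rectangle z w := fun a b ha hb ha' hb' ζ hζ =>
    ⟨uIcc_subset_uIcc ha hb hζ.1, uIcc_subset_uIcc ha' hb' hζ.2⟩
  by_contra! hcon
  have c1 := hcon z m (sub _ _ (by simp) h1 (by simp) h2) (by rw [hm]; ring)
  have c2 := hcon ⟨m.re, z.im⟩ ⟨w.re, m.im⟩ (sub _ _ h1 (by simp) (by simp) h2)
    (by apply Complex.ext <;> simp [mre, mim] <;> ring)
  have c3 := hcon ⟨z.re, m.im⟩ ⟨m.re, w.im⟩ (sub _ _ (by simp) h1 h2 (by simp))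
    (by apply Complex.ext <;> simp [mre, mim] <;> ring)
  have c4 := hcon m w (sub _ _ h1 (by simp) h2 (by simp)) (by rw [hm]; ring)
  have := norm_add₄_le (a := rectInt f z m) (b := rectInt f ⟨m.re, z.im⟩ ⟨w.re, m.im⟩)
    (c := rectInt f ⟨z.re, m.im⟩ ⟨m.re, w.im⟩) (d := rectInt f m w)
  rw [← key] at this
  linarith

/-- Goursat's argument: a continuous function whose integral around small rectangles containing
a point is of smaller order than the square of the diameter is holomorphic. -/
theorem differentiableOn_of_rectInt_small {f : ℂ → ℂ} {V : Set ℂ} (hV : IsOpen V)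
    (hf : ContinuousOn f V)
    (h : ∀ z₀ ∈ V, ∀ ε > 0, ∃ δ > 0, ∀ z w : ℂ, Rectangle z w ⊆ V → z₀ ∈ Rectangle z w →
      ‖w - z‖ < δ → ‖rectInt f z w‖ ≤ ε * ‖w - z‖ ^ 2) :
    DifferentiableOn ℂ f V := by
  refine (isConservativeOn_and_continuousOn_iff_isDifferentiableOn hV).1 ⟨fun z w hzw => ?_, hf⟩
  rw [← add_eq_zero_iff_eq_neg]
  change rectInt f z w = 0
  have step : ∀ q : {q : ℂ × ℂ // Rectangle q.1 q.2 ⊆ V}, ∃ q' : {q : ℂ × ℂ // Rectangle q.1 q.2 ⊆ V},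
      Rectangle q'.1.1 q'.1.2 ⊆ Rectangle q.1.1 q.1.2 ∧ q'.1.2 - q'.1.1 = (q.1.2 - q.1.1) / 2 ∧
      ‖rectInt f q.1.1 q.1.2‖ / 4 ≤ ‖rectInt f q'.1.1 q'.1.2‖ := by
    rintro ⟨⟨a, b⟩, hab⟩
    obtain ⟨a', b', h1, h2, h3⟩ := exists_quarter (hf.mono hab)
    exact ⟨⟨⟨a', b'⟩, h1.trans hab⟩, h1, h2, h3⟩
  choose T hT1 hT2 hT3 using step
  let q : ℕ → {q : ℂ × ℂ // Rectangle q.1 q.2 ⊆ V} := fun n => T^[n] ⟨(z, w), hzw⟩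
  have qs : ∀ n, q (n + 1) = T (q n) := fun n => Function.iterate_succ_apply' T n _
  have hdiff : ∀ n, (q n).1.2 - (q n).1.1 = (w - z) / 2 ^ n := by
    intro n
    induction n with
    | zero => simp [q]
    | succ n ih => rw [qs, hT2, ih]; field_simp; ring
  have hnorm : ∀ n, ‖rectInt f z w‖ / 4 ^ n ≤ ‖rectInt f (q n).1.1 (q n).1.2‖ := by
    intro n
    induction n with
    | zero => simp [q]
    | succ n ih =>
      rw [qs]
      refine le_trans ?_ (hT3 _)
      rw [pow_succ, ← div_div]
      gcongr
  obtain ⟨z₀, hz₀⟩ := IsCompact.nonempty_iInter_of_sequence_nonempty_isCompact_isClosed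
    (fun n => Rectangle (q n).1.1 (q n).1.2) (fun n => by simpa only [qs] using hT1 (q n))
    (fun n => ⟨(q n).1.1, by simp [mem_Rectangle_iff]⟩) (isCompact_Rectangle _ _)
    (fun n => (isCompact_Rectangle _ _).isClosed)
  rw [mem_iInter] at hz₀
  have hz₀V : z₀ ∈ V := (q 0).2 (hz₀ 0)
  have bound : ∀ ε > 0, ‖rectInt f z w‖ ≤ ε * ‖w - z‖ ^ 2 := by
    intro ε hε
    obtain ⟨δ, hδ, H⟩ := h z₀ hz₀V ε hε
    have hlim : Tendsto (fun n : ℕ => ‖w - z‖ * (1 / 2 : ℝ) ^ n) atTop (𝓝 (‖w - z‖ * 0)) :=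
      (tendsto_pow_atTop_nhds_zero_of_lt_one (by norm_num) (by norm_num)).const_mul _
    rw [mul_zero] at hlim
    obtain ⟨n, hn⟩ := ((tendsto_order.1 hlim).2 δ hδ).exists
    have hd : ‖(q n).1.2 - (q n).1.1‖ = ‖w - z‖ * (1 / 2 : ℝ) ^ n := by
      rw [hdiff]; simp [div_eq_mul_inv]
    have := (hnorm n).trans (H _ _ (q n).2 (hz₀ n) (hd ▸ hn))
    rw [hd, mul_pow, ← pow_mul, mul_comm n 2, pow_mul, ← mul_assoc] at this
    norm_num at this
    rw [div_pow, one_pow, mul_one_div] at this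
    exact (div_le_div_iff_of_pos_right (by positivity)).1 this
  by_contra hne
  have hpos : 0 < ‖rectInt f z w‖ := norm_pos_iff.2 hne
  -- The summand `1` keeps the denominator positive when `z = w`.
  have := bound (‖rectInt f z w‖ / (2 * (‖w - z‖ ^ 2 + 1))) (by positivity)
  rw [div_mul_eq_mul_div, le_div_iff₀ (by positivity)] at this
  nlinarith [sq_nonneg ‖w - z‖]

/-! ### Dependence of the extension on the circle -/

/-- `g` is continuous on the closed disc, holomorphic inside, and equals `f` on the circle. -/
def IsHolExtension (f g : ℂ → ℂ) (c : ℂ) (r : ℝ) : Prop :=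
  ContinuousOn g (closedBall c r) ∧ DifferentiableOn ℂ g (ball c r) ∧ EqOn g f (sphere c r)

/-- Maximum principle, after both discs are rescaled to the unit disc. -/
theorem norm_extension_sub_le {f g₁ g₂ : ℂ → ℂ} {c₁ c₂ : ℂ} {r₁ r₂ C : ℝ} (hr₁ : 0 < r₁)
    (hr₂ : 0 < r₂) (h₁ : IsHolExtension f g₁ c₁ r₁) (h₂ : IsHolExtension f g₂ c₂ r₂)
    (hC : ∀ ζ : ℂ, ‖ζ‖ = 1 → ‖f (c₁ + r₁ * ζ) - f (c₂ + r₂ * ζ)‖ ≤ C) {ζ : ℂ} (hζ : ‖ζ‖ ≤ 1) :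
    ‖g₁ (c₁ + r₁ * ζ) - g₂ (c₂ + r₂ * ζ)‖ ≤ C := by
  have aux : ∀ {g : ℂ → ℂ} {c : ℂ} {r : ℝ}, 0 < r → IsHolExtension f g c r →
      DiffContOnCl ℂ (fun ζ => g (c + r * ζ)) (ball 0 1) := by
    intro g c r hr h
    refine ⟨h.2.1.comp (by fun_prop) fun ζ hζ => ?_, ?_⟩
    · rw [mem_ball_zero_iff] at hζ
      simpa [abs_of_pos hr] using mul_lt_mul_of_pos_left hζ hr
    · rw [closure_ball _ one_ne_zero]
      refine h.1.comp (by fun_prop) fun ζ hζ => ?_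
      rw [mem_closedBall_zero_iff] at hζ
      simpa [abs_of_pos hr] using mul_le_mul_of_nonneg_left hζ hr.le
  have hd := (aux hr₁ h₁).sub (aux hr₂ h₂)
  refine norm_le_of_forall_mem_frontier_norm_le isBounded_ball hd (fun ζ hζ => ?_)
    (by rw [closure_ball _ one_ne_zero]; simpa using hζ)
  rw [frontier_ball _ one_ne_zero, mem_sphere_zero_iff_norm] at hζ
  have e1 := h₁.2.2 (x := c₁ + r₁ * ζ) (by simp [hζ, hr₁.le])
  have e2 := h₂.2.2 (x := c₂ + r₂ * ζ) (by simp [hζ, hr₂.le])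
  simpa [e1, e2] using hC ζ hζ

/-- The extension is determined by its boundary values, so no coherence of the choice `G` is needed.
Carry the disc of radius `R` affinely onto that of radius `R₀` by `ψ`: uniform continuity of `f`
makes the boundary values close, and the maximum principle makes the extensions close. -/
theorem continuousOn_extension {f : ℂ → ℂ} (hf : UniformContinuous f) {c : ℝ → ℂ}
    (hc : Continuous c) {S : Set ℝ} (hS : ∀ R ∈ S, 0 < R) {G : ℝ → ℂ → ℂ}
    (hG : ∀ R ∈ S, IsHolExtension f (G R) (c R) R) :
    ContinuousOn (fun q : ℂ × ℝ => G q.2 q.1) {q | q.2 ∈ S ∧ q.1 ∈ closedBall (c q.2) q.2} := by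
  rintro ⟨z₀, R₀⟩ ⟨hR₀, hz₀⟩
  dsimp only at hR₀ hz₀
  have hR₀p := hS _ hR₀
  set D := {q : ℂ × ℝ | q.2 ∈ S ∧ q.1 ∈ closedBall (c q.2) q.2} with hD
  have hnorm : ∀ q ∈ D, ‖(q.1 - c q.2) / q.2‖ ≤ 1 := by
    rintro ⟨z, R⟩ ⟨hR, hz⟩
    have := hS R hR
    rw [mem_closedBall, dist_eq_norm] at hz
    simpa [abs_of_pos this] using div_le_one_of_le₀ hz this.le
  let ψ : ℂ × ℝ → ℂ := fun q => c R₀ + R₀ * ((q.1 - c q.2) / q.2)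
  have hψ : ContinuousWithinAt ψ D (z₀, R₀) := by
    apply ContinuousAt.continuousWithinAt
    have : ((z₀, R₀) : ℂ × ℝ).2 ≠ 0 := hR₀p.ne'
    apply ContinuousAt.add continuousAt_const
    apply ContinuousAt.mul continuousAt_const
    apply ContinuousAt.div (by fun_prop) (by fun_prop)
    simpa using this
  have hψ0 : ψ (z₀, R₀) = z₀ := by
    have : (R₀ : ℂ) ≠ 0 := by exact_mod_cast hR₀p.ne'
    simp only [ψ]; field_simp; ring
  have hψD : MapsTo ψ D (closedBall (c R₀) R₀) := by
    intro q hq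
    have := hnorm q hq
    simp only [ψ, mem_closedBall, dist_eq_norm, add_sub_cancel_left, norm_mul]
    rw [norm_real, Real.norm_eq_abs, abs_of_pos hR₀p]
    nlinarith
  have h2 : Tendsto (fun q => G R₀ (ψ q)) (𝓝[D] (z₀, R₀)) (𝓝 (G R₀ z₀)) := by
    have := ((hG R₀ hR₀).1 (ψ (z₀, R₀)) (hψD ⟨hR₀, hz₀⟩)).comp hψ hψD
    simpa [ContinuousWithinAt, Function.comp_def, hψ0] using this
  have h1 : Tendsto (fun q : ℂ × ℝ => G q.2 q.1 - G R₀ (ψ q)) (𝓝[D] (z₀, R₀)) (𝓝 0) := by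
    rw [Metric.tendsto_nhds]
    intro ε hε
    obtain ⟨δ, hδ, H⟩ := Metric.uniformContinuous_iff.1 hf (ε / 2) (by positivity)
    have hlim : Tendsto (fun q : ℂ × ℝ => ‖c q.2 - c R₀‖ + |q.2 - R₀|) (𝓝[D] (z₀, R₀)) (𝓝 0) := by
      have : Continuous (fun q : ℂ × ℝ => ‖c q.2 - c R₀‖ + |q.2 - R₀|) := by fun_prop
      simpa using (this.tendsto (z₀, R₀)).mono_left nhdsWithin_le_nhds
    filter_upwards [(tendsto_order.1 hlim).2 δ hδ, self_mem_nhdsWithin] with q hq hqD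
    have hqp := hS _ hqD.1
    have hqc : (q.2 : ℂ) ≠ 0 := by exact_mod_cast hqp.ne'
    have key := norm_extension_sub_le hqp hR₀p (hG _ hqD.1) (hG _ hR₀) (C := ε / 2)
      (fun ζ hζ => by
        rw [← dist_eq_norm]
        refine (H ?_).le
        rw [dist_eq_norm]
        refine lt_of_le_of_lt ?_ hq
        calc ‖c q.2 + q.2 * ζ - (c R₀ + R₀ * ζ)‖ = ‖(c q.2 - c R₀) + ((q.2 - R₀ : ℝ) : ℂ) * ζ‖ := by
              congr 1; push_cast; ring
          _ ≤ ‖c q.2 - c R₀‖ + ‖((q.2 - R₀ : ℝ) : ℂ) * ζ‖ := norm_add_le _ _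
          _ = _ := by rw [norm_mul, hζ, mul_one, norm_real, Real.norm_eq_abs]) (hnorm q hqD)
    rw [mul_div_cancel₀ _ hqc, add_sub_cancel] at key
    rw [dist_zero_right]
    exact lt_of_le_of_lt key (by linarith)
  have := h1.add h2
  simpa [ContinuousWithinAt] using this

/-! ### Fibre integrals with a moving lower limit -/

theorem continuousOn_intervalIntegral_of_continuousOn {X : Type*} [TopologicalSpace X]
    [FirstCountableTopology X] {s : Set X} {ρ : X → ℝ} {b : ℝ} {F : X → ℝ → ℂ}
    (hρ : ContinuousOn ρ s)
    (hF : ContinuousOn (fun q : X × ℝ => F q.1 q.2) {q | q.1 ∈ s ∧ q.2 ∈ [[ρ q.1, b]]}) :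
    ContinuousOn (fun x => ∫ t in ρ x..b, F x t) s := by
  rw [continuousOn_iff_continuous_domRestrict] at hρ ⊢
  -- Clamping `t` between `ρ x` and `b` gives an integrand continuous on all of `s × ℝ` without
  -- changing the integral.
  let κ : s × ℝ → ℝ := fun q => max (min (ρ q.1) b) (min (max (ρ q.1) b) q.2)
  have hρ' : Continuous (fun x : s => ρ x) := hρ
  have hκ : Continuous κ := by
    have : Continuous (fun q : s × ℝ => ρ q.1) := hρ'.comp continuous_fst
    exact (this.min continuous_const).max ((this.max continuous_const).min continuous_snd)
  have hcl : Continuous (Function.uncurry fun (x : s) (t : ℝ) => F x (κ (x, t))) := by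
    refine hF.comp_continuous (f := fun q : s × ℝ => ((q.1 : X), κ q)) (by fun_prop) fun q => ?_
    refine ⟨q.1.2, ?_⟩
    simp only [κ, uIcc, mem_Icc]
    exact ⟨le_max_left _ _, max_le (min_le_of_left_le (le_max_left _ _)) (min_le_left _ _)⟩
  have h := intervalIntegral.continuous_parametric_intervalIntegral_of_continuous (μ := volume)
    (a₀ := b) hcl hρ'
  refine h.neg.congr fun x => ?_
  simp only [domRestrict_apply, Pi.neg_apply]
  rw [← intervalIntegral.integral_symm]
  refine intervalIntegral.integral_congr fun t ht => ?_
  have : κ (x, t) = t := by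
    simp only [κ]
    rw [min_eq_right ht.2, max_eq_right ht.1]
  simp only [this]

theorem rectInt_intervalIntegral_eq_zero {K : ℂ → ℝ → ℂ} {z w : ℂ} {a b : ℝ}
    (hK : ContinuousOn (fun q : ℂ × ℝ => K q.1 q.2) (Rectangle z w ×ˢ [[a, b]]))
    (h : ∀ R ∈ Ι a b, rectInt (fun ζ => K ζ R) z w = 0) :
    rectInt (fun ζ => ∫ R in a..b, K ζ R) z w = 0 := by
  have swap : ∀ {γ : ℝ → ℂ} {p q : ℝ}, Continuous γ → MapsTo γ [[p, q]] (Rectangle z w) →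
      (∫ x in p..q, ∫ R in a..b, K (γ x) R) = (∫ R in a..b, ∫ x in p..q, K (γ x) R) ∧
      IntervalIntegrable (fun R => ∫ x in p..q, K (γ x) R) volume a b := by
    intro γ p q hγ hm
    constructor
    · apply intervalIntegral_intervalIntegral_swap
      refine IntegrableOn.mono_set (t := [[p, q]] ×ˢ [[a, b]]) ?_
        (prod_mono uIoc_subset_uIcc uIoc_subset_uIcc)
      apply ContinuousOn.integrableOn_compact (isCompact_uIcc.prod isCompact_uIcc)
      exact hK.comp (f := fun q : ℝ × ℝ => (γ q.1, q.2)) (by fun_prop)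
        fun q hq => ⟨hm hq.1, hq.2⟩
    · apply ContinuousOn.intervalIntegrable
      refine continuousOn_intervalIntegral_of_continuousOn (F := fun R x => K (γ x) R)
        (ρ := fun _ => p) continuousOn_const ?_
      exact hK.comp (f := fun q : ℝ × ℝ => (γ q.2, q.1)) (by fun_prop)
        fun q hq => ⟨hm hq.2, hq.1⟩
  obtain ⟨e1, i1⟩ := swap (γ := fun x : ℝ => x + z.im * I) (p := z.re) (q := w.re) (by fun_prop)
    fun x hx => by simpa [mem_Rectangle_iff] using hx
  obtain ⟨e2, i2⟩ := swap (γ := fun x : ℝ => x + w.im * I) (p := z.re) (q := w.re) (by fun_prop)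
    fun x hx => by simpa [mem_Rectangle_iff] using hx
  obtain ⟨e3, i3⟩ := swap (γ := fun y : ℝ => w.re + y * I) (p := z.im) (q := w.im) (by fun_prop)
    fun x hx => by simpa [mem_Rectangle_iff] using hx
  obtain ⟨e4, i4⟩ := swap (γ := fun y : ℝ => z.re + y * I) (p := z.im) (q := w.im) (by fun_prop)
    fun x hx => by simpa [mem_Rectangle_iff] using hx
  rw [rectInt_eq, e1, e2, e3, e4, ← intervalIntegral.integral_const_mul,
    ← intervalIntegral.integral_const_mul, ← intervalIntegral.integral_sub i1 i2,
    ← intervalIntegral.integral_add (i1.sub i2) (i3.const_mul I),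
    ← intervalIntegral.integral_sub ((i1.sub i2).add (i3.const_mul I)) (i4.const_mul I)]
  refine intervalIntegral.integral_zero_ae (ae_of_all _ fun R hR => ?_)
  simpa only [rectInt_eq] using h R hR

/-- A family of functions `H · R`, continuous on `ρ ≤ R` and holomorphic on `ρ < R`. -/
structure HolFamily (V : Set ℂ) (ρ : ℂ → ℝ) (H : ℂ → ℝ → ℂ) : Prop where
  continuousOn_level : ContinuousOn ρ V
  continuousOn : ContinuousOn (fun q : ℂ × ℝ => H q.1 q.2) {q | q.1 ∈ V ∧ ρ q.1 ≤ q.2}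
  differentiableOn : ∀ R, DifferentiableOn ℂ (fun z => H z R) {z ∈ V | ρ z < R}

theorem HolFamily.continuousOn_integral {V : Set ℂ} {ρ : ℂ → ℝ} {H : ℂ → ℝ → ℂ}
    (hH : HolFamily V ρ H) {B : ℝ} (hB : ∀ z ∈ V, ρ z ≤ B) :
    ContinuousOn (fun z => ∫ R in ρ z..B, H z R) V :=
  continuousOn_intervalIntegral_of_continuousOn hH.continuousOn_level
    (hH.continuousOn.mono fun q hq => ⟨hq.1, by
      have := hq.2; rw [uIcc_of_le (hB _ hq.1)] at this; exact this.1⟩)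

/-- Formally the `∂̄`-derivative of the fibre integral is `-H(z, ρ z) ∂̄ρ`. The family is only
continuous up to `R = ρ z`, so this is stated in integrated form, with `H` frozen at `z₀`. -/
theorem HolFamily.rectInt_integral {V : Set ℂ} {ρ : ℂ → ℝ} {H : ℂ → ℝ → ℂ}
    (hH : HolFamily V ρ H) {B : ℝ} (hB : ∀ z ∈ V, ρ z < B) {z₀ : ℂ} (hz₀ : z₀ ∈ V)
    (hρ : DifferentiableAt ℝ ρ z₀) {ε : ℝ} (hε : 0 < ε) :
    ∃ δ > 0, ∀ z w : ℂ, Rectangle z w ⊆ V → z₀ ∈ Rectangle z w → ‖w - z‖ < δ →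
      ‖rectInt (fun ζ => ∫ R in ρ ζ..B, H ζ R) z w +
        rectInt (fun ζ => H z₀ (ρ z₀) * ρ ζ) z w‖ ≤ ε * ‖w - z‖ ^ 2 := by
  obtain ⟨C, hC, hlip⟩ := hρ.isBigO_sub.exists_pos
  obtain ⟨δ₁, hδ₁, hlip⟩ := Metric.eventually_nhds_iff.1 hlip.bound
  have hcont := hH.continuousOn (z₀, ρ z₀) ⟨hz₀, le_rfl⟩
  obtain ⟨η, hη, hcont⟩ := Metric.continuousWithinAt_iff.1 hcont (ε / (8 * C)) (by positivity)
  have hB0 : 0 < B - ρ z₀ := sub_pos.2 (hB _ hz₀)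
  -- The bound `η / C` keeps the radii within `η` of `ρ z₀`, and the last bound ensures `R' ≤ B`.
  refine ⟨min (min δ₁ η) (min (η / C) ((B - ρ z₀) / C)), by positivity, fun z w hV' hz₀' hd => ?_⟩
  obtain ⟨⟨hd1, hd2⟩, hd3, hd4⟩ : (‖w - z‖ < δ₁ ∧ ‖w - z‖ < η) ∧ ‖w - z‖ < η / C ∧
    ‖w - z‖ < (B - ρ z₀) / C := by simpa using hd
  rw [lt_div_iff₀ hC] at hd3 hd4
  set d := ‖w - z‖
  have hd0 : 0 ≤ d := norm_nonneg _
  -- `R'` dominates `ρ` on the rectangle. Above `R'` the integrand is holomorphic there and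
  -- contributes nothing; below it the range has length at most `2 * C * d`, so replacing `H` by
  -- `H₀` costs `O(ε * d)` pointwise.
  set R' := ρ z₀ + C * d with hR'
  set H₀ := H z₀ (ρ z₀)
  have hdist : ∀ ζ ∈ Rectangle z w, dist ζ z₀ ≤ d := fun ζ hζ => by
    rw [dist_eq_norm]; exact dist_le_of_mem_Rectangle hζ hz₀'
  have hρζ : ∀ ζ ∈ Rectangle z w, |ρ ζ - ρ z₀| ≤ C * d := fun ζ hζ => by
    have h1 := hdist ζ hζ
    have h2 := hlip (h1.trans_lt hd1)
    rw [← dist_eq_norm, Real.dist_eq, ← dist_eq_norm] at h2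
    exact h2.trans (by gcongr)
  have hle : ∀ ζ ∈ Rectangle z w, ρ ζ ≤ R' := fun ζ hζ => by
    have := (abs_le.1 (hρζ ζ hζ)).2; linarith
  have hR'B : R' ≤ B := by rw [hR']; linarith
  have hHV : HolFamily (Rectangle z w) ρ H :=
    ⟨hH.continuousOn_level.mono hV', hH.continuousOn.mono fun q hq => ⟨hV' hq.1, hq.2⟩,
      fun R => (hH.differentiableOn R).mono fun q hq => ⟨hV' hq.1, hq.2⟩⟩
  have hρc : ContinuousOn (fun ζ => (ρ ζ : ℂ)) (Rectangle z w) :=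
    continuous_ofReal.comp_continuousOn hHV.continuousOn_level
  have hInt : ∀ ζ ∈ Rectangle z w, ∀ {a b : ℝ}, ρ ζ ≤ a → ρ ζ ≤ b →
      IntervalIntegrable (fun R => H ζ R) volume a b := by
    intro ζ hζ a b ha hb
    apply ContinuousOn.intervalIntegrable
    refine hHV.continuousOn.comp (f := fun R : ℝ => (ζ, R)) (by fun_prop) fun R hR => ⟨hζ, ?_⟩
    exact (le_min ha hb).trans hR.1
  have hKc : ContinuousOn (fun q : ℂ × ℝ => H q.1 q.2) (Rectangle z w ×ˢ [[R', B]]) :=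
    hHV.continuousOn.mono fun q hq => ⟨hq.1, (hle _ hq.1).trans (by
      have := hq.2; rw [uIcc_of_le hR'B] at this; exact this.1)⟩
  have hupper : rectInt (fun ζ => ∫ R in R'..B, H ζ R) z w = 0 := by
    refine rectInt_intervalIntegral_eq_zero hKc fun R hR => ?_
    rw [uIoc_of_le hR'B] at hR
    refine rectInt_eq_zero fun ζ hζ => DifferentiableWithinAt.mono (t := {z ∈ V | ρ z < R}) ?_
      fun ξ hξ => ⟨hV' hξ, (hle ξ hξ).trans_lt hR.1⟩
    exact hH.differentiableOn R ζ ⟨hV' hζ, (hle ζ hζ).trans_lt hR.1⟩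
  have cont1 : ContinuousOn (fun ζ => ∫ R in ρ ζ..R', H ζ R) (Rectangle z w) :=
    hHV.continuousOn_integral hle
  have cont2 : ContinuousOn (fun ζ => ∫ R in R'..B, H ζ R) (Rectangle z w) :=
    continuousOn_intervalIntegral_of_continuousOn continuousOn_const hKc
  have hsplit : rectInt (fun ζ => ∫ R in ρ ζ..B, H ζ R) z w =
      rectInt (fun ζ => ∫ R in ρ ζ..R', H ζ R) z w := by
    rw [rectInt_congr (g := fun ζ => (∫ R in ρ ζ..R', H ζ R) + ∫ R in R'..B, H ζ R),
      rectInt_add cont1 cont2, hupper, add_zero]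
    intro ζ hζ
    exact (intervalIntegral.integral_add_adjacent_intervals (hInt ζ hζ le_rfl (hle ζ hζ))
      (hInt ζ hζ (hle ζ hζ) ((hle ζ hζ).trans hR'B))).symm
  have hconst : rectInt (fun _ => H₀ * R') z w = 0 := rectInt_eq_zero (differentiableOn_const _)
  have heq : rectInt (fun ζ => ∫ R in ρ ζ..B, H ζ R) z w + rectInt (fun ζ => H₀ * ρ ζ) z w =
      rectInt (fun ζ => ∫ R in ρ ζ..R', (H ζ R - H₀)) z w := by
    rw [hsplit, ← rectInt_add cont1 (by fun_prop), ← sub_zero (rectInt _ _ _), ← hconst,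
      ← rectInt_sub (by fun_prop) continuousOn_const]
    refine rectInt_congr fun ζ hζ => ?_
    rw [intervalIntegral.integral_sub (hInt ζ hζ le_rfl (hle ζ hζ)) (by simp)]
    simp only [intervalIntegral.integral_const, real_smul]
    push_cast
    ring
  rw [heq]
  refine (norm_rectInt_le (M := ε / (8 * C) * (2 * (C * d))) fun ζ hζ => ?_).trans_eq
    (by field_simp; ring)
  refine (intervalIntegral.norm_integral_le_of_norm_le_const (C := ε / (8 * C))
    fun R hR => ?_).trans ?_
  · rw [uIoc_of_le (hle ζ hζ)] at hR
    rw [← dist_eq_norm]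
    have h1 := abs_le.1 (hρζ ζ hζ)
    refine (hcont (x := (ζ, R)) ⟨hV' hζ, hR.1.le⟩ ?_).le
    rw [Prod.dist_eq, max_lt_iff]
    refine ⟨(hdist ζ hζ).trans_lt hd2, ?_⟩
    rw [Real.dist_eq, abs_lt]
    constructor <;> linarith [hR.1, hR.2]
  · have h1 := abs_le.1 (hρζ ζ hζ)
    gcongr
    rw [abs_le]
    constructor <;> linarith

/-- If the boundary contributions of two families cancel to first order at every point, then the
difference of their fibre integrals is holomorphic. -/
theorem differentiableOn_integral_sub_integral {V : Set ℂ} (hV : IsOpen V) {ρ₁ ρ₂ : ℂ → ℝ}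
    {H₁ H₂ : ℂ → ℝ → ℂ} (h₁ : HolFamily V ρ₁ H₁) (h₂ : HolFamily V ρ₂ H₂) {B : ℝ}
    (hB₁ : ∀ z ∈ V, ρ₁ z < B) (hB₂ : ∀ z ∈ V, ρ₂ z < B)
    (hρ₁ : ∀ z ∈ V, DifferentiableAt ℝ ρ₁ z) (hρ₂ : ∀ z ∈ V, DifferentiableAt ℝ ρ₂ z)
    (hcancel : ∀ z₀ ∈ V, DifferentiableAt ℂ
      (fun z => H₁ z₀ (ρ₁ z₀) * ρ₁ z - H₂ z₀ (ρ₂ z₀) * ρ₂ z) z₀) :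
    DifferentiableOn ℂ (fun z => (∫ R in ρ₁ z..B, H₁ z R) - ∫ R in ρ₂ z..B, H₂ z R) V := by
  have c1 := h₁.continuousOn_integral (fun z hz => (hB₁ z hz).le)
  have c2 := h₂.continuousOn_integral (fun z hz => (hB₂ z hz).le)
  refine differentiableOn_of_rectInt_small hV (c1.sub c2) fun z₀ hz₀ ε hε => ?_
  obtain ⟨δ₁, hδ₁, H1⟩ := h₁.rectInt_integral hB₁ hz₀ (hρ₁ z₀ hz₀) (ε := ε / 3) (by positivity)
  obtain ⟨δ₂, hδ₂, H2⟩ := h₂.rectInt_integral hB₂ hz₀ (hρ₂ z₀ hz₀) (ε := ε / 3) (by positivity)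
  have hP := (hcancel z₀ hz₀).hasDerivAt
  set P := fun z => H₁ z₀ (ρ₁ z₀) * ρ₁ z - H₂ z₀ (ρ₂ z₀) * ρ₂ z with hPdef
  have hPb := (hasDerivAt_iff_isLittleO.1 hP).bound (c := ε / 12) (by positivity)
  obtain ⟨δ₃, hδ₃, H3⟩ := Metric.eventually_nhds_iff.1 hPb
  refine ⟨min δ₁ (min δ₂ δ₃), by positivity, fun z w hzw hz₀' hd => ?_⟩
  obtain ⟨hd1, hd2, hd3⟩ : ‖w - z‖ < δ₁ ∧ ‖w - z‖ < δ₂ ∧ ‖w - z‖ < δ₃ := by simpa using hd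
  have r1 : ContinuousOn (fun ζ => H₁ z₀ (ρ₁ z₀) * (ρ₁ ζ : ℂ)) (Rectangle z w) :=
    continuousOn_const.mul (continuous_ofReal.comp_continuousOn (h₁.continuousOn_level.mono hzw))
  have r2 : ContinuousOn (fun ζ => H₂ z₀ (ρ₂ z₀) * (ρ₂ ζ : ℂ)) (Rectangle z w) :=
    continuousOn_const.mul (continuous_ofReal.comp_continuousOn (h₂.continuousOn_level.mono hzw))
  have hPc : ContinuousOn P (Rectangle z w) := r1.sub r2
  have hPint : ‖rectInt P z w‖ ≤ ε / 3 * ‖w - z‖ ^ 2 := by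
    have haff : rectInt (fun ζ => P z₀ + (ζ - z₀) * deriv P z₀) z w = 0 :=
      rectInt_eq_zero (by fun_prop)
    rw [← sub_zero (rectInt P z w), ← haff, ← rectInt_sub hPc (by fun_prop)]
    refine (norm_rectInt_le (M := ε / 12 * ‖w - z‖) fun ζ hζ => ?_).trans_eq (by ring)
    have hζd := dist_le_of_mem_Rectangle hζ hz₀'
    have := H3 (y := ζ) (by rw [dist_eq_norm]; exact hζd.trans_lt hd3)
    rw [smul_eq_mul] at this
    rw [← sub_sub]
    exact this.trans (by gcongr)
  have e1 := H1 z w hzw hz₀' hd1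
  have e2 := H2 z w hzw hz₀' hd2
  rw [rectInt_sub (c1.mono hzw) (c2.mono hzw)]
  have hPs : rectInt P z w = rectInt (fun ζ => H₁ z₀ (ρ₁ z₀) * (ρ₁ ζ : ℂ)) z w -
      rectInt (fun ζ => H₂ z₀ (ρ₂ z₀) * (ρ₂ ζ : ℂ)) z w := rectInt_sub r1 r2
  set A₁ := rectInt (fun ζ => ∫ R in ρ₁ ζ..B, H₁ ζ R) z w
  set A₂ := rectInt (fun ζ => ∫ R in ρ₂ ζ..B, H₂ ζ R) z w
  have : A₁ - A₂ = (A₁ + rectInt (fun ζ => H₁ z₀ (ρ₁ z₀) * (ρ₁ ζ : ℂ)) z w) -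
      (A₂ + rectInt (fun ζ => H₂ z₀ (ρ₂ z₀) * (ρ₂ ζ : ℂ)) z w) - rectInt P z w := by
    rw [hPs]; ring
  rw [this]
  refine (norm_sub_le _ _).trans ((add_le_add (norm_sub_le _ _) le_rfl).trans ?_)
  linarith

/-! ### Geometry of the two families of circles -/

/-- Square of the radius of the circle centred at `0` through `z`. -/
noncomputable def sqRadius (z : ℂ) : ℝ := z.re ^ 2 + z.im ^ 2

/-- Radius of the circle through `z` tangent to the unit circle at `1`. -/
noncomputable def horoRadius (z : ℂ) : ℝ := ((1 - z.re) ^ 2 + z.im ^ 2) / (2 * (1 - z.re))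

theorem sqRadius_eq (z : ℂ) : sqRadius z = ‖z‖ ^ 2 := by
  rw [← normSq_eq_norm_sq, normSq_apply, sqRadius]; ring

theorem norm_sub_horoCenter_sq (z : ℂ) (R : ℝ) :
    ‖z - (1 - R)‖ ^ 2 = (z.re - (1 - R)) ^ 2 + z.im ^ 2 := by
  rw [← normSq_eq_norm_sq, normSq_apply]
  simp only [sub_re, one_re, ofReal_re, sub_im, one_im, ofReal_im]
  ring

theorem mem_closedBall_horo {z : ℂ} {R : ℝ} (hz : z.re < 1) (hR : 0 < R) :
    z ∈ closedBall (1 - R : ℂ) R ↔ horoRadius z ≤ R := by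
  rw [mem_closedBall, dist_eq_norm, ← abs_of_pos hR, ← abs_norm, ← sq_le_sq,
    norm_sub_horoCenter_sq, horoRadius, div_le_iff₀ (by linarith), abs_of_pos hR]
  constructor <;> intro h <;> nlinarith

theorem mem_ball_horo {z : ℂ} {R : ℝ} (hz : z.re < 1) (hR : 0 < R) :
    z ∈ ball (1 - R : ℂ) R ↔ horoRadius z < R := by
  rw [mem_ball, dist_eq_norm, ← abs_of_pos hR, ← abs_norm, ← sq_lt_sq,
    norm_sub_horoCenter_sq, horoRadius, div_lt_iff₀ (by linarith), abs_of_pos hR]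
  constructor <;> intro h <;> nlinarith

theorem mem_sphere_horo {z : ℂ} (hz : z.re < 1) : z ∈ sphere (1 - horoRadius z : ℂ) (horoRadius z) := by
  have h0 : 0 < horoRadius z := by
    have : 0 < 1 - z.re := by linarith
    unfold horoRadius; positivity
  have h1 := (mem_closedBall_horo hz h0).2 le_rfl
  have h2 := mt (mem_ball_horo hz h0).1 (lt_irrefl _)
  exact le_antisymm h1 (not_lt.1 h2)

theorem half_le_horoRadius {z : ℂ} (hz : z.re < 1) : (1 - z.re) / 2 ≤ horoRadius z := by
  rw [horoRadius, div_le_div_iff₀ two_pos (by linarith)]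
  nlinarith [sq_nonneg z.im]

theorem one_lt_horoRadius {z : ℂ} (hz : z.re < 1) (h : 1 < ‖z‖) : 1 < horoRadius z := by
  have h2 : 1 < sqRadius z := by rw [sqRadius_eq]; nlinarith
  rw [sqRadius] at h2
  rw [horoRadius, lt_div_iff₀ (by linarith)]
  nlinarith

theorem hasFDerivAt_horoRadius {z : ℂ} (hz : z.re < 1) :
    HasFDerivAt horoRadius
      ((-1 / 2 + z.im ^ 2 / (2 * (1 - z.re) ^ 2)) • reCLM + (z.im / (1 - z.re)) • imCLM) z := by
  have hre : HasFDerivAt (fun z : ℂ => z.re) reCLM z := reCLM.hasFDerivAt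
  have him : HasFDerivAt (fun z : ℂ => z.im) imCLM z := imCLM.hasFDerivAt
  have hne : (1 - z.re) ≠ 0 := by linarith
  have hden : 2 * (1 - z.re) ≠ 0 := mul_ne_zero two_ne_zero hne
  have h := (((hre.const_sub 1).pow 2).add (him.pow 2)).mul
    ((hasDerivAt_inv hden).comp_hasFDerivAt z ((hre.const_sub 1).const_mul 2))
  have e : horoRadius = fun z : ℂ => ((1 - z.re) ^ 2 + z.im ^ 2) * (2 * (1 - z.re))⁻¹ := by
    ext z; rw [horoRadius, div_eq_mul_inv]
  rw [e]
  refine h.congr_fderiv ?_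
  ext
  all_goals
    simp
    field_simp
    ring

theorem hasFDerivAt_sqRadius (z : ℂ) :
    HasFDerivAt sqRadius ((2 * z.re) • reCLM + (2 * z.im) • imCLM) z := by
  have hre : HasFDerivAt (fun z : ℂ => z.re) reCLM z := reCLM.hasFDerivAt
  have him : HasFDerivAt (fun z : ℂ => z.im) imCLM z := imCLM.hasFDerivAt
  refine ((hre.pow 2).add (him.pow 2)).congr_fderiv ?_
  ext
  all_goals simp

/-- The hypothesis is the Cauchy–Riemann equation: `∂̄ sqRadius = z` and `∂̄ horoRadius = -(1 - z)²
/ (4 * (1 - Re z)²)`. -/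
theorem differentiableAt_comb {z₀ α β : ℂ} (hz : z₀.re < 1)
    (h : β * (1 - z₀) ^ 2 = 4 * α * z₀ * (1 - z₀.re) ^ 2) :
    DifferentiableAt ℂ (fun z => α * sqRadius z + β * horoRadius z) z₀ := by
  have h1 : HasFDerivAt (fun z => (sqRadius z : ℂ)) _ z₀ :=
    ofRealCLM.hasFDerivAt.comp z₀ (hasFDerivAt_sqRadius z₀)
  have h2 : HasFDerivAt (fun z => (horoRadius z : ℂ)) _ z₀ :=
    ofRealCLM.hasFDerivAt.comp z₀ (hasFDerivAt_horoRadius hz)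
  have h3 := (h1.const_mul α).fun_add (h2.const_mul β)
  rw [differentiableAt_complex_iff_differentiableAt_real]
  refine ⟨h3.differentiableAt, ?_⟩
  have hne : (1 - z₀.re : ℂ) ≠ 0 := by
    have : (1 - z₀.re) ≠ 0 := by linarith
    exact_mod_cast this
  have hdec := re_add_im z₀
  set x : ℝ := z₀.re
  set y : ℝ := z₀.im
  rw [← hdec] at h
  rw [HasFDerivAt.fderiv h3]
  simp
  field_simp
  linear_combination I * h + (4 * y * α * (1 - x) ^ 2 + 2 * y * β * (1 - x) - y ^ 2 * β * I) * I_sq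

/-! ### The two kernels -/

/-- Numerator of the product `z * w` along the complexified circle `horo R`. -/
noncomputable def horoNum (z : ℂ) (R : ℝ) : ℂ := z * (2 * R - 1 + (1 - R) * z)

/-- Denominator of the product `z * w` along the complexified circle `horo R`. -/
noncomputable def horoDen (z : ℂ) (R : ℝ) : ℂ := z - 1 + R

/-- This equals `1/(T - t₁) - 1/(T - t₂)` off the poles. A single Cauchy kernel would have, on the
tangent circles, a further pole at the centre `z = 1 - R`, where `T = ∞`; the difference has none.
-/
noncomputable def sqKernel (t₁ t₂ : ℂ) (T : ℝ) : ℂ := (t₁ - t₂) / ((T - t₁) * (T - t₂))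

/-- The pullback of `sqKernel t₁ t₂ T dT` under `T = horoNum z R / horoDen z R` with `z` fixed,
since `dT/dR = -z * (1 - z)² / horoDen²`. -/
noncomputable def horoKernel (t₁ t₂ z : ℂ) (R : ℝ) : ℂ :=
  -((t₁ - t₂) * z * (1 - z) ^ 2) /
    ((horoNum z R - t₁ * horoDen z R) * (horoNum z R - t₂ * horoDen z R))

/-- This gives the sign of `Im T`: for `R < 1` and `z` strictly inside the circle, off the real
axis, `T` and `z` lie on opposite sides of that axis. -/
theorem horoNum_mul_conj_im (z : ℂ) (R : ℝ) : (horoNum z R * (starRingEnd ℂ) (horoDen z R)).im =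
    (1 - R) * z.im * ((z.re - (1 - R)) ^ 2 + z.im ^ 2 - R ^ 2) := by
  simp [horoNum, horoDen]
  ring

theorem horoNum_sub_ne_zero {z t : ℂ} {R σ : ℝ} (hz0 : 0 < z.re) (hR : 0 < R)
    (hsign : σ * ((1 - R) * z.im * ((z.re - (1 - R)) ^ 2 + z.im ^ 2 - R ^ 2)) ≤ 0)
    (ht : 0 < σ * t.im) : horoNum z R - t * horoDen z R ≠ 0 := by
  intro h
  have h1 : horoNum z R = t * horoDen z R := sub_eq_zero.1 h
  have h2 := horoNum_mul_conj_im z R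
  rw [h1, mul_assoc, mul_conj, im_mul_ofReal] at h2
  rw [← h2, ← mul_assoc] at hsign
  have h3 : normSq (horoDen z R) = 0 := by
    have := normSq_nonneg (horoDen z R)
    by_contra hne
    have : 0 < normSq (horoDen z R) := lt_of_le_of_ne this (Ne.symm hne)
    nlinarith [mul_pos ht this]
  rw [normSq_eq_zero] at h3
  rw [h3, mul_zero] at h1
  have hz : z = 1 - R := by unfold horoDen at h3; linear_combination h3
  have hz0' : z ≠ 0 := fun h => by simp [h] at hz0
  unfold horoNum at h1
  have h4 := (mul_eq_zero.1 h1).resolve_left hz0'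
  rw [hz] at h4
  have : (R : ℂ) ^ 2 = 0 := by linear_combination h4
  have : (R : ℂ) = 0 := by simpa using this
  exact hR.ne' (by exact_mod_cast this)

/-- On the circle through `z` itself, `horoNum / horoDen` takes the value `|z|²`, so both kernels
are evaluated at the same `T`. The resulting relation is the hypothesis of `differentiableAt_comb`.
-/
theorem kernel_relation {z t₁ t₂ : ℂ} (hz : z.re < 1) (hz0 : 0 < z.re) :
    -horoKernel t₁ t₂ z (horoRadius z) * (1 - z) ^ 2 =
      4 * sqKernel t₁ t₂ (sqRadius z) * z * (1 - z.re) ^ 2 := by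
  have hne : (1 - z.re : ℂ) ≠ 0 := by
    have : (1 - z.re) ≠ 0 := by linarith
    exact_mod_cast this
  have hne' : 1 - z ≠ 0 := fun h => by
    have := congrArg re h; simp at this; linarith
  have hdec := re_add_im z
  have hρ : (horoRadius z : ℂ) = ((1 - z.re) ^ 2 + z.im ^ 2) / (2 * (1 - z.re)) := by
    rw [horoRadius]; push_cast; rfl
  have hs : (sqRadius z : ℂ) = z.re ^ 2 + z.im ^ 2 := by rw [sqRadius]; push_cast; rfl
  have hD : horoDen z (horoRadius z) = -(1 - z) ^ 2 / (2 * (1 - z.re)) := by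
    rw [horoDen, hρ]
    field_simp
    generalize (z.re : ℂ) = x at *
    generalize (z.im : ℂ) = y at *
    subst hdec
    ring_nf
    simp
  have hN : horoNum z (horoRadius z) = sqRadius z * horoDen z (horoRadius z) := by
    rw [hD, horoNum, hρ, hs]
    field_simp
    generalize (z.re : ℂ) = x at *
    generalize (z.im : ℂ) = y at *
    subst hdec
    ring_nf
    simp
    ring
  rw [horoKernel, sqKernel, hN, ← sub_mul, ← sub_mul, hD]
  generalize (sqRadius z : ℂ) - t₁ = a
  generalize (sqRadius z : ℂ) - t₂ = b
  by_cases ha : a = 0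
  · simp [ha]
  by_cases hb : b = 0
  · simp [hb]
  field_simp
  ring

/-! ### Holomorphy and vanishing of the difference of fibre integrals -/

/-- A uniformly continuous function together with its extensions from the circles centred at `0`
and from the circles of radius at least `τ` tangent to the unit circle at `1`; the extensions from
circles of radius at least `1` vanish. -/
structure CirclePair (f : ℂ → ℂ) (τ : ℝ) (G₁ G₂ : ℝ → ℂ → ℂ) : Prop where
  uniformContinuous : UniformContinuous f
  pos : 0 < τ
  lt_half : τ < 1 / 2
  ext₁ : ∀ R, 0 < R → IsHolExtension f (G₁ R) 0 R
  ext₂ : ∀ R, τ ≤ R → IsHolExtension f (G₂ R) (1 - R) R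
  eq_zero₁ : ∀ R, 1 ≤ R → ∀ z, G₁ R z = 0
  eq_zero₂ : ∀ R, 1 ≤ R → ∀ z, G₂ R z = 0

/-- The part of a vertical strip of width `δ` in the closed half plane given by the sign `σ`. -/
def halfStrip (σ δ : ℝ) : Set ℂ := {z | 0 ≤ σ * z.im ∧ 0 < z.re ∧ z.re < δ ∧ ‖z‖ < 2}

def openHalfStrip (σ δ : ℝ) : Set ℂ := {z | 0 < σ * z.im ∧ 0 < z.re ∧ z.re < δ ∧ ‖z‖ < 2}

theorem openHalfStrip_subset (σ δ : ℝ) : openHalfStrip σ δ ⊆ halfStrip σ δ :=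
  fun _ h => ⟨h.1.le, h.2⟩

theorem isOpen_openHalfStrip (σ δ : ℝ) : IsOpen (openHalfStrip σ δ) :=
  (isOpen_lt continuous_const (continuous_const.mul continuous_im)).inter
    ((isOpen_lt continuous_const continuous_re).inter
      ((isOpen_lt continuous_re continuous_const).inter (isOpen_lt continuous_norm continuous_const)))

theorem convex_openHalfStrip (σ δ : ℝ) : Convex ℝ (openHalfStrip σ δ) := by
  have h : openHalfStrip σ δ = {z : ℂ | 0 < (σ • imLm) z} ∩ ({z : ℂ | 0 < reLm z} ∩
      ({z : ℂ | reLm z < δ} ∩ ball 0 2)) := by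
    ext z; simp [openHalfStrip]
  rw [h]
  exact (convex_halfSpace_gt (LinearMap.isLinear _) _).inter
    ((convex_halfSpace_gt (LinearMap.isLinear _) _).inter
      ((convex_halfSpace_lt (LinearMap.isLinear _) _).inter (convex_ball _ _)))

section families

variable {f : ℂ → ℂ} {τ : ℝ} {G₁ G₂ : ℝ → ℂ → ℂ} {σ : ℝ} {t₁ t₂ : ℂ}

theorem continuous_sqRadius : Continuous sqRadius := by unfold sqRadius; fun_prop

theorem ofReal_sub_ne_zero {t : ℂ} (ht : 0 < σ * t.im) (T : ℝ) : (T : ℂ) - t ≠ 0 := fun h => by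
  have := congrArg im h
  simp only [sub_im, ofReal_im, zero_sub, zero_im, neg_eq_zero] at this
  simp [this] at ht

/-- Inside the circle `T` lies in the closed half plane opposite to `z`, while `t` lies in the open
one containing the strip. For `R > 1` the sign would reverse; capping at `1` is harmless because the
extensions vanish there. -/
theorem horoDenominator_ne_zero {z t : ℂ} {R : ℝ} (hz : z ∈ halfStrip σ (1 - 2 * τ))
    (hτ : 0 < τ) (hR : horoRadius z ≤ R) (ht : 0 < σ * t.im) :
    horoNum z (min R 1) - t * horoDen z (min R 1) ≠ 0 := by
  have hz1 : z.re < 1 := by linarith [hz.2.2.1]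
  have hρ : 0 < horoRadius z := by linarith [half_le_horoRadius hz1]
  refine horoNum_sub_ne_zero hz.2.1 (lt_min (hρ.trans_le hR) one_pos) ?_ ht
  rcases le_total R 1 with h | h
  · rw [min_eq_left h]
    have h1 := (mem_closedBall_horo hz1 (hρ.trans_le hR)).2 hR
    rw [mem_closedBall, dist_eq_norm] at h1
    have h2 : ‖z - (1 - R)‖ ^ 2 ≤ R ^ 2 := by gcongr
    rw [norm_sub_horoCenter_sq] at h2
    have h3 : 0 ≤ σ * z.im * (1 - R) := mul_nonneg hz.1 (by linarith)
    nlinarith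
  · rw [min_eq_right h]; simp

theorem CirclePair.holFamily₁ (h : CirclePair f τ G₁ G₂) (ht₁ : 0 < σ * t₁.im)
    (ht₂ : 0 < σ * t₂.im) : HolFamily (halfStrip σ (1 - 2 * τ)) sqRadius
      (fun z T => G₁ √T z * sqKernel t₁ t₂ T) := by
  have hcirc : ∀ z : ℂ, ∀ T, sqRadius z ≤ T → ‖z‖ ≤ √T := fun z T hT =>
    Real.le_sqrt_of_sq_le (by rwa [← sqRadius_eq])
  have hpos : ∀ z ∈ halfStrip σ (1 - 2 * τ), 0 < sqRadius z := fun z hz => by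
    have := hz.2.1; unfold sqRadius; positivity
  refine ⟨continuous_sqRadius.continuousOn, ContinuousOn.mul ?_ ?_, fun R => ?_⟩
  · have hc := continuousOn_extension (c := fun _ => 0) h.uniformContinuous continuous_const
      (S := Ioi 0) (fun _ hR => hR) h.ext₁
    refine hc.comp (f := fun q : ℂ × ℝ => (q.1, √q.2)) (by fun_prop) ?_
    rintro ⟨z, T⟩ ⟨hz, hT⟩
    refine ⟨Real.sqrt_pos.2 ((hpos z hz).trans_le hT), ?_⟩
    simpa using hcirc z T hT
  · apply Continuous.continuousOn
    unfold sqKernel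
    refine Continuous.div (by fun_prop) (by fun_prop) fun q => ?_
    exact mul_ne_zero (ofReal_sub_ne_zero ht₁ _) (ofReal_sub_ne_zero ht₂ _)
  · refine DifferentiableOn.mul_const ?_ _
    rcases le_or_gt R 0 with hR | hR
    · intro z hz
      exact absurd ((hpos z hz.1).trans hz.2) (not_lt.2 hR)
    · refine (h.ext₁ _ (Real.sqrt_pos.2 hR)).2.1.mono fun z hz => ?_
      rw [mem_ball_zero_iff]
      exact Real.lt_sqrt_of_sq_lt (by rw [← sqRadius_eq]; exact hz.2)

/-- The width `1 - 2 * τ` is what makes `horoRadius z ≥ (1 - Re z) / 2 ≥ τ`, so that only circles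
with a given extension occur. -/
theorem CirclePair.holFamily₂ (h : CirclePair f τ G₁ G₂) (ht₁ : 0 < σ * t₁.im)
    (ht₂ : 0 < σ * t₂.im) : HolFamily (halfStrip σ (1 - 2 * τ)) horoRadius
      (fun z R => G₂ R z * horoKernel t₁ t₂ z (min R 1)) := by
  have hτ := h.pos
  have hz1 : ∀ z ∈ halfStrip σ (1 - 2 * τ), z.re < 1 := fun z hz => by linarith [hz.2.2.1]
  have hge : ∀ z ∈ halfStrip σ (1 - 2 * τ), τ ≤ horoRadius z := fun z hz => by
    linarith [half_le_horoRadius (hz1 z hz), hz.2.2.1]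
  refine ⟨fun z hz => (hasFDerivAt_horoRadius (hz1 z hz)).continuousAt.continuousWithinAt,
    ContinuousOn.mul ?_ ?_, fun R => ?_⟩
  · have hc := continuousOn_extension (c := fun R => 1 - R) h.uniformContinuous (by fun_prop)
      (S := Ici τ) (fun _ hR => hτ.trans_le hR) h.ext₂
    refine hc.mono fun q hq => ⟨(hge _ hq.1).trans hq.2, ?_⟩
    exact (mem_closedBall_horo (hz1 _ hq.1) (hτ.trans_le ((hge _ hq.1).trans hq.2))).2 hq.2
  · have hne : ∀ q ∈ {q : ℂ × ℝ | q.1 ∈ halfStrip σ (1 - 2 * τ) ∧ horoRadius q.1 ≤ q.2},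
        (horoNum q.1 (min q.2 1) - t₁ * horoDen q.1 (min q.2 1)) *
          (horoNum q.1 (min q.2 1) - t₂ * horoDen q.1 (min q.2 1)) ≠ 0 := fun q hq =>
      mul_ne_zero (horoDenominator_ne_zero hq.1 hτ hq.2 ht₁)
        (horoDenominator_ne_zero hq.1 hτ hq.2 ht₂)
    unfold horoKernel
    refine ContinuousOn.div (by fun_prop) ?_ hne
    unfold horoNum horoDen
    fun_prop
  · have hne : ∀ z ∈ {z ∈ halfStrip σ (1 - 2 * τ) | horoRadius z < R},
        (horoNum z (min R 1) - t₁ * horoDen z (min R 1)) *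
          (horoNum z (min R 1) - t₂ * horoDen z (min R 1)) ≠ 0 := fun z hz =>
      mul_ne_zero (horoDenominator_ne_zero hz.1 hτ hz.2.le ht₁)
        (horoDenominator_ne_zero hz.1 hτ hz.2.le ht₂)
    rcases lt_or_ge R τ with hR | hR
    · intro z hz
      exact absurd ((hge z hz.1).trans hz.2.le) (not_le.2 hR)
    · refine DifferentiableOn.mul ((h.ext₂ R hR).2.1.mono fun z hz => ?_) ?_
      · exact (mem_ball_horo (hz1 _ hz.1) (hτ.trans_le hR)).2 hz.2
      · unfold horoKernel
        refine DifferentiableOn.div (by fun_prop) ?_ hne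
        unfold horoNum horoDen
        fun_prop

theorem HolFamily.mono {V W : Set ℂ} {ρ : ℂ → ℝ} {H : ℂ → ℝ → ℂ} (hH : HolFamily W ρ H)
    (hV : V ⊆ W) : HolFamily V ρ H :=
  ⟨hH.continuousOn_level.mono hV, hH.continuousOn.mono fun _ hq => ⟨hV hq.1, hq.2⟩,
    fun R => (hH.differentiableOn R).mono fun _ hq => ⟨hV hq.1, hq.2⟩⟩

theorem CirclePair.cancel (h : CirclePair f τ G₁ G₂) {z : ℂ} (hz : z ∈ halfStrip σ (1 - 2 * τ)) :
    DifferentiableAt ℂ (fun ζ => G₁ √(sqRadius z) z * sqKernel t₁ t₂ (sqRadius z) * sqRadius ζ -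
      G₂ (horoRadius z) z * horoKernel t₁ t₂ z (min (horoRadius z) 1) * horoRadius ζ) z := by
  have hτ := h.pos
  have hz1 : z.re < 1 := by linarith [hz.2.2.1]
  have hge : τ ≤ horoRadius z := by linarith [half_le_horoRadius hz1, hz.2.2.1]
  have hsq : √(sqRadius z) = ‖z‖ := by rw [sqRadius_eq, Real.sqrt_sq (norm_nonneg _)]
  have hz0 : 0 < ‖z‖ := norm_pos_iff.2 fun h0 => by simpa [h0] using hz.2.1
  have e1 : G₁ √(sqRadius z) z = f z := by
    rw [hsq]; exact (h.ext₁ _ hz0).2.2 (by simp)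
  have e2 : G₂ (horoRadius z) z = f z := (h.ext₂ _ hge).2.2 (mem_sphere_horo hz1)
  rcases le_or_gt (horoRadius z) 1 with hle | hgt
  · have := differentiableAt_comb (z₀ := z) (α := f z * sqKernel t₁ t₂ (sqRadius z))
      (β := -(f z * horoKernel t₁ t₂ z (horoRadius z))) hz1 (by
        linear_combination f z * kernel_relation (t₁ := t₁) (t₂ := t₂) hz1 hz.2.1)
    rw [e1, e2, min_eq_left hle]
    simpa [sub_eq_add_neg] using this
  -- Here the cap makes the kernel relation fail, but both coefficients vanish with `f z`.
  · have : f z = 0 := by rw [← e2]; exact h.eq_zero₂ _ hgt.le z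
    simp [e1, e2, this]

theorem horoRadius_le {z : ℂ} {τ : ℝ} (hτ : 0 < τ) (hz : z ∈ halfStrip σ (1 - 2 * τ)) :
    horoRadius z < 4 + 2 / τ := by
  have h1 : z.im ^ 2 < 4 := by
    have := hz.2.2.2
    have h2 : sqRadius z < 4 := by rw [sqRadius_eq]; nlinarith [norm_nonneg z]
    rw [sqRadius] at h2; nlinarith
  have hx := hz.2.2.1
  have hx0 := hz.2.1
  have h3 : 0 < 2 / τ := by positivity
  have h4 : 2 / τ * τ = 2 := by field_simp
  rw [horoRadius, div_lt_iff₀ (by linarith)]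
  nlinarith

theorem CirclePair.integral_eq (h : CirclePair f τ G₁ G₂) (hσ : σ ^ 2 = 1) (ht₁ : 0 < σ * t₁.im)
    (ht₂ : 0 < σ * t₂.im) {x : ℝ} (hx0 : 0 < x) (hx : x < 1 - 2 * τ) :
    (∫ T in sqRadius x..(4 + 2 / τ), G₁ √T x * sqKernel t₁ t₂ T) =
      ∫ R in horoRadius x..(4 + 2 / τ), G₂ R x * horoKernel t₁ t₂ x (min R 1) := by
  have hτ := h.pos
  set δ := 1 - 2 * τ with hδ
  have hδ1 : δ < 1 := by linarith
  have hδ0 : 0 < δ := by linarith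
  -- One upper limit above both level functions on the strip: `|z| < 2` gives `sqRadius z < 4`, and
  -- `1 - Re z > 2 * τ` bounds `horoRadius z`.
  set B := 4 + 2 / τ with hB
  have hB4 : 4 < B := by have : 0 < 2 / τ := by positivity
                         linarith
  have hBs : ∀ z ∈ halfStrip σ δ, sqRadius z < B := fun z hz => by
    rw [sqRadius_eq]; nlinarith [hz.2.2.2, norm_nonneg z]
  have hBh : ∀ z ∈ halfStrip σ δ, horoRadius z < B := fun z hz => horoRadius_le hτ hz
  have F1 := h.holFamily₁ ht₁ ht₂
  have F2 := h.holFamily₂ ht₁ ht₂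
  have hsub := openHalfStrip_subset σ δ
  set J : ℂ → ℂ := fun z => (∫ T in sqRadius z..B, G₁ √T z * sqKernel t₁ t₂ T) -
    ∫ R in horoRadius z..B, G₂ R z * horoKernel t₁ t₂ z (min R 1) with hJ
  have hJc : ContinuousOn J (halfStrip σ δ) :=
    (F1.continuousOn_integral fun z hz => (hBs z hz).le).sub
      (F2.continuousOn_integral fun z hz => (hBh z hz).le)
  have hJd : DifferentiableOn ℂ J (openHalfStrip σ δ) :=
    differentiableOn_integral_sub_integral (isOpen_openHalfStrip σ δ) (F1.mono hsub) (F2.mono hsub)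
      (fun z hz => hBs z (hsub hz)) (fun z hz => hBh z (hsub hz))
      (fun z _ => (hasFDerivAt_sqRadius z).differentiableAt)
      (fun z hz => (hasFDerivAt_horoRadius (hz.2.2.1.trans hδ1)).differentiableAt)
      (fun z hz => h.cancel (hsub hz))
  -- Both lower limits exceed `1`, where the extensions are zero.
  have hJ0 : ∀ z ∈ halfStrip σ δ, 1 < ‖z‖ → J z = 0 := by
    intro z hz hz1
    have h1 : 1 < sqRadius z := by rw [sqRadius_eq]; nlinarith
    have h2 := one_lt_horoRadius (hz.2.2.1.trans hδ1) hz1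
    simp only [hJ]
    rw [intervalIntegral.integral_congr (g := fun _ => 0),
      intervalIntegral.integral_congr (a := horoRadius z) (g := fun _ => 0)]
    · simp
    · intro R hR
      rw [uIcc_of_le (hBh z hz).le] at hR
      simp [h.eq_zero₂ R (h2.le.trans hR.1)]
    · intro T hT
      rw [uIcc_of_le (hBs z hz).le] at hT
      simp [h.eq_zero₁ √T (Real.one_le_sqrt.2 (h1.le.trans hT.1))]
  have hσ' : σ * σ = 1 := by rw [← sq, hσ]
  have hJV : EqOn J 0 (openHalfStrip σ δ) := by
    -- Height `3/2` places `z₁` outside the unit disc but inside `|z| < 2`.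
    let z₁ : ℂ := ⟨δ / 2, σ * (3 / 2)⟩
    have hn : sqRadius z₁ = δ ^ 2 / 4 + 9 / 4 := by
      simp only [sqRadius, z₁]; linear_combination (9 / 4) * hσ
    rw [sqRadius_eq] at hn
    have hz₁1 : 1 < ‖z₁‖ := by
      by_contra! hc
      nlinarith [norm_nonneg z₁]
    have hz₁ : z₁ ∈ openHalfStrip σ δ := by
      refine ⟨?_, ?_, ?_, ?_⟩
      · simp only [z₁]; rw [← mul_assoc, hσ']; norm_num
      · simp only [z₁]; linarith
      · simp only [z₁]; linarith
      · by_contra! hc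
        nlinarith
    refine (hJd.analyticOnNhd (isOpen_openHalfStrip σ δ)).eqOn_zero_of_preconnected_of_eventuallyEq_zero
      (convex_openHalfStrip σ δ).isPreconnected hz₁ ?_
    filter_upwards [(isOpen_openHalfStrip σ δ).mem_nhds hz₁,
      (isOpen_lt continuous_const continuous_norm).mem_nhds hz₁1] with z hz hz'
    exact hJ0 z (hsub hz) hz'
  have hxs : (x : ℂ) ∈ halfStrip σ δ := by
    refine ⟨by simp, by simpa, by simpa, ?_⟩
    rw [norm_real, Real.norm_eq_abs, abs_of_pos hx0]; linarith
  have hxc : (x : ℂ) ∈ closure (openHalfStrip σ δ) := by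
    have hlim : Tendsto (fun η : ℝ => (x : ℂ) + (σ * η : ℝ) * I) (𝓝[>] 0) (𝓝 (x : ℂ)) := by
      have : Continuous (fun η : ℝ => (x : ℂ) + (σ * η : ℝ) * I) := by fun_prop
      simpa using (this.tendsto 0).mono_left nhdsWithin_le_nhds
    refine mem_closure_of_tendsto hlim ?_
    filter_upwards [hlim.eventually ((isOpen_lt continuous_norm continuous_const).mem_nhds hxs.2.2.2),
      self_mem_nhdsWithin] with η hη hη0
    refine ⟨?_, by simpa using hx0, by simpa using hx, hη⟩
    have : 0 < σ * σ * η := by rw [hσ', one_mul]; exact hη0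
    simpa [mul_assoc] using this
  have hJx : J x = 0 := by
    have := hJV.of_subset_closure (t := insert (x : ℂ) (openHalfStrip σ δ))
      (hJc.mono (insert_subset hxs hsub)) continuousOn_const (subset_insert _ _)
      (insert_subset hxc subset_closure)
    exact this (mem_insert _ _)
  exact sub_eq_zero.1 hJx

end families

/-! ### Poisson kernels and the jump across the real axis -/

theorem integral_mul_poisson_eq (g : ℝ → ℂ) (a : ℝ) {b : ℝ} (hb : 0 < b) :
    ∫ T, g T * (b / ((T - a) ^ 2 + b ^ 2) : ℝ) = ∫ s, g (a + b * s) * ((1 + s ^ 2)⁻¹ : ℝ) := by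
  rw [← integral_add_left_eq_self (fun T => g T * (b / ((T - a) ^ 2 + b ^ 2) : ℝ)) a]
  have h := Measure.integral_comp_mul_left
    (fun T => g (a + T) * (b / ((a + T - a) ^ 2 + b ^ 2) : ℝ)) b
  rw [abs_of_pos (inv_pos.2 hb)] at h
  rw [eq_comm, inv_smul_eq_iff₀ hb.ne'] at h
  rw [h, ← integral_smul]
  refine integral_congr_ae (ae_of_all _ fun s => ?_)
  simp only [real_smul]
  rw [mul_left_comm, ← ofReal_mul]
  congr 2
  field_simp
  ring_nf

theorem tendsto_integral_mul_poisson {g : ℝ → ℂ} {a M : ℝ} (hg : StronglyMeasurable g)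
    (hM : ∀ T, ‖g T‖ ≤ M) (ha : ContinuousAt g a) :
    Tendsto (fun b : ℝ => ∫ T, g T * (b / ((T - a) ^ 2 + b ^ 2) : ℝ)) (𝓝[>] 0)
      (𝓝 (g a * Real.pi)) := by
  have hlim : Tendsto (fun b : ℝ => ∫ s, g (a + b * s) * ((1 + s ^ 2)⁻¹ : ℝ)) (𝓝[>] 0)
      (𝓝 (∫ s : ℝ, g a * ((1 + s ^ 2)⁻¹ : ℝ))) := by
    refine tendsto_integral_filter_of_dominated_convergence (fun s => M * (1 + s ^ 2)⁻¹)
      (Eventually.of_forall fun b => ?_) (Eventually.of_forall fun b => ae_of_all _ fun s => ?_)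
      (integrable_inv_one_add_sq.const_mul M) (ae_of_all _ fun s => ?_)
    · refine ((hg.comp_measurable (by fun_prop)).mul ?_).aestronglyMeasurable
      exact (by fun_prop : Measurable fun s : ℝ => (((1 + s ^ 2)⁻¹ : ℝ) : ℂ)).stronglyMeasurable
    · rw [norm_mul, norm_real, Real.norm_of_nonneg (by positivity)]
      gcongr
      exact hM _
    · refine Tendsto.mul_const _ ?_
      have h1 : Tendsto (fun b : ℝ => a + b * s) (𝓝[>] 0) (𝓝 a) := by
        have : Continuous (fun b : ℝ => a + b * s) := by fun_prop
        simpa using (this.tendsto 0).mono_left nhdsWithin_le_nhds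
      exact ha.tendsto.comp h1
  rw [integral_const_mul, integral_complex_ofReal, integral_univ_inv_one_add_sq] at hlim
  refine hlim.congr' ?_
  filter_upwards [self_mem_nhdsWithin] with b hb
  exact (integral_mul_poisson_eq g a hb).symm

/-- Cutting `g` off to zero outside the interval keeps it bounded and measurable and does not affect
it near the interior point `a`. -/
theorem tendsto_intervalIntegral_mul_poisson {g : ℝ → ℂ} {p q a : ℝ}
    (hg : ContinuousOn g (Icc p q)) (hpa : p < a) (haq : a < q) :
    Tendsto (fun b : ℝ => ∫ T in p..q, g T * (b / ((T - a) ^ 2 + b ^ 2) : ℝ)) (𝓝[>] 0)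
      (𝓝 (g a * Real.pi)) := by
  have hpq : p ≤ q := (hpa.trans haq).le
  let e : ℝ → ℂ := IccExtend hpq ((Icc p q).domRestrict g)
  have he : Continuous e := (continuousOn_iff_continuous_domRestrict.1 hg).Icc_extend'
  have heq : ∀ T ∈ Icc p q, e T = g T := fun T hT => IccExtend_of_mem hpq _ hT
  obtain ⟨M, hM⟩ := isCompact_Icc.exists_bound_of_continuousOn hg
  have hM0 : 0 ≤ M := (norm_nonneg _).trans (hM p ⟨le_rfl, hpq⟩)
  have hnear : (Ioc p q).indicator e =ᶠ[𝓝 a] g := by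
    filter_upwards [Ioo_mem_nhds hpa haq] with T hT
    rw [indicator_of_mem (show T ∈ Ioc p q from ⟨hT.1, hT.2.le⟩), heq T ⟨hT.1.le, hT.2.le⟩]
  have hga : ContinuousAt g a := hg.continuousAt (Icc_mem_nhds hpa haq)
  have h := tendsto_integral_mul_poisson (g := (Ioc p q).indicator e) (a := a) (M := M)
    (he.stronglyMeasurable.indicator measurableSet_Ioc) (fun T => by
      by_cases hT : T ∈ Ioc p q
      · rw [indicator_of_mem hT, heq T ⟨hT.1.le, hT.2⟩]; exact hM T ⟨hT.1.le, hT.2⟩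
      · rw [indicator_of_notMem hT]; simpa using hM0)
    (hga.congr hnear.symm)
  rw [hnear.eq_of_nhds] at h
  refine h.congr fun b => ?_
  rw [intervalIntegral.integral_of_le hpq, ← integral_indicator measurableSet_Ioc]
  congr 1
  ext T
  by_cases hT : T ∈ Ioc p q
  · rw [indicator_of_mem hT, indicator_of_mem hT, heq T ⟨hT.1.le, hT.2⟩]
  · rw [indicator_of_notMem hT, indicator_of_notMem hT, zero_mul]

/-- The poles `a ± ib` are conjugate, so the jump of each Cauchy kernel is `2i` times the Poisson
kernel at height `b`. -/
theorem sqKernel_sub_sqKernel {a₁ a₂ b : ℝ} (hb : 0 < b) (T : ℝ) :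
    sqKernel (a₁ + b * I) (a₂ + b * I) T - sqKernel (a₁ + (-b : ℝ) * I) (a₂ + (-b : ℝ) * I) T =
      2 * I * ((b / ((T - a₁) ^ 2 + b ^ 2) : ℝ) - (b / ((T - a₂) ^ 2 + b ^ 2) : ℝ)) := by
  have hne : ∀ a c : ℝ, c ≠ 0 → (T - (a + c * I) : ℂ) ≠ 0 := fun a c hc h => by
    have := congrArg im h
    simp at this
    exact hc this
  have hfac : ∀ a : ℝ, (((T - a) ^ 2 + b ^ 2 : ℝ) : ℂ) =
      (T - (a + b * I)) * (T - (a + (-b : ℝ) * I)) := fun a => by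
    push_cast
    linear_combination (b : ℂ) ^ 2 * I_sq
  have key : ∀ {u₁ u₂ v₁ v₂ : ℂ}, u₁ ≠ 0 → u₂ ≠ 0 → v₁ ≠ 0 → v₂ ≠ 0 →
      (u₂ - u₁) / (u₁ * u₂) - (v₂ - v₁) / (v₁ * v₂) =
        (v₁ - u₁) / (u₁ * v₁) - (v₂ - u₂) / (u₂ * v₂) := by
    intro u₁ u₂ v₁ v₂ h1 h2 h3 h4
    field_simp
    ring
  have h := key (hne a₁ b hb.ne') (hne a₂ b hb.ne') (hne a₁ (-b) (neg_ne_zero.2 hb.ne'))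
    (hne a₂ (-b) (neg_ne_zero.2 hb.ne'))
  unfold sqKernel
  rw [ofReal_div, ofReal_div, hfac, hfac, mul_sub (2 * I), ← mul_div_assoc, ← mul_div_assoc]
  convert h using 3
  all_goals
    push_cast
    ring

/-! ### Vanishing of the centred extensions -/

section

variable {f : ℂ → ℂ} {τ : ℝ} {G₁ G₂ : ℝ → ℂ → ℂ}

/-- The real part is affine in `R`, and positive at both ends: `T = x²` at `R = (1 - x) / 2` and `T
= 1` at `R = 1`. Thus `T` avoids `(x², 1)`, and the kernel stays regular as `b` crosses zero. -/
theorem horoNum_sub_ofReal_ne_zero {x a R : ℝ} (hx0 : 0 < x) (hx1 : x < 1) (ha : x ^ 2 < a)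
    (ha1 : a < 1) (hR : (1 - x) / 2 ≤ R) (hR1 : R ≤ 1) (b : ℝ) :
    horoNum x R - (a + b * I) * horoDen x R ≠ 0 := by
  intro h
  have h1 := congrArg re h
  simp [horoNum, horoDen] at h1
  have e : x * (2 * R - 1 + (1 - R) * x) - a * (x - 1 + R) =
      ((2 * R - (1 - x)) * (x * (1 - a)) + (1 - R) * ((1 - x) * (a - x ^ 2))) / (1 + x) := by
    field_simp; ring
  rw [e, div_eq_zero_iff] at h1
  have h2 : 0 < x * (1 - a) := mul_pos hx0 (by linarith)
  have h3 : 0 < (1 - x) * (a - x ^ 2) := mul_pos (by linarith) (by linarith)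
  have h4 : 0 ≤ (2 * R - (1 - x)) * (x * (1 - a)) := mul_nonneg (by linarith) h2.le
  have h5 : 0 ≤ (1 - R) * ((1 - x) * (a - x ^ 2)) := mul_nonneg (by linarith) h3.le
  rcases h1 with h1 | h1
  · rcases eq_or_lt_of_le hR1 with hR2 | hR2
    · subst hR2
      nlinarith
    · nlinarith [mul_pos (sub_pos.2 hR2) h3]
  · linarith

theorem CirclePair.continuousOn_ext₁ (h : CirclePair f τ G₁ G₂) {x : ℝ} (hx0 : 0 < x) :
    ContinuousOn (fun T : ℝ => G₁ √T x) (Ici (x ^ 2)) := by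
  have hc := continuousOn_extension (c := fun _ => 0) h.uniformContinuous continuous_const
    (S := Ioi 0) (fun _ hR => hR) h.ext₁
  refine hc.comp (f := fun T : ℝ => ((x : ℂ), √T)) (by fun_prop) fun T hT => ?_
  have : x ≤ √T := Real.le_sqrt_of_sq_le hT
  refine ⟨hx0.trans_le this, ?_⟩
  simpa [abs_of_pos hx0] using this

/-- Compare `CirclePair.integral_eq` for poles at height `b` in the upper strip and `-b` in the
lower. As `b → 0` the centred side tends to `2πi` times the difference of the two values, while the
tangent side `L b - L (-b)` tends to zero. -/
theorem CirclePair.ext₁_eq (h : CirclePair f τ G₁ G₂) {x a₁ a₂ : ℝ} (hx0 : 0 < x)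
    (hx : x < 1 - 2 * τ) (ha₁ : x ^ 2 < a₁) (ha₁' : a₁ < 1) (ha₂ : x ^ 2 < a₂) (ha₂' : a₂ < 1) :
    G₁ √a₁ x = G₁ √a₂ x := by
  have hτ := h.pos
  have hx1 : x < 1 := by linarith
  have hxW : (x : ℂ) ∈ halfStrip 1 (1 - 2 * τ) := by
    refine ⟨by simp, by simpa, by simpa, ?_⟩
    rw [norm_real, Real.norm_eq_abs, abs_of_pos hx0]; linarith
  have hs : sqRadius (x : ℂ) = x ^ 2 := by simp [sqRadius]
  have hh : horoRadius (x : ℂ) = (1 - x) / 2 := by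
    have : 1 - x ≠ 0 := by linarith
    simp only [horoRadius, ofReal_re, ofReal_im]; field_simp; ring
  set B := 4 + 2 / τ with hB
  have hB4 : 4 < B := by have : 0 < 2 / τ := by positivity
                         linarith
  have hBh : (1 - x) / 2 ≤ B := by linarith
  have hxB : x ^ 2 ≤ B := by nlinarith
  let L : ℝ → ℂ := fun b => ∫ R in ((1 - x) / 2)..B,
    G₂ R x * horoKernel (a₁ + b * I) (a₂ + b * I) x (min R 1)
  have hL : Continuous L := by
    rw [← continuousOn_univ]
    refine continuousOn_intervalIntegral_of_continuousOn (X := ℝ) (ρ := fun _ => (1 - x) / 2)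
      (F := fun b R => G₂ R x * horoKernel (a₁ + b * I) (a₂ + b * I) x (min R 1))
      continuousOn_const ?_
    have hmem : ∀ q ∈ {q : ℝ × ℝ | q.1 ∈ univ ∧ q.2 ∈ [[(1 - x) / 2, B]]}, (1 - x) / 2 ≤ q.2 :=
      fun q hq => by have := hq.2; rw [uIcc_of_le hBh] at this; exact this.1
    refine ContinuousOn.mul ?_ ?_
    · have hc := continuousOn_extension (c := fun R => 1 - R) h.uniformContinuous (by fun_prop)
        (S := Ici τ) (fun _ hR => hτ.trans_le hR) h.ext₂
      refine hc.comp (f := fun q : ℝ × ℝ => ((x : ℂ), q.2)) (by fun_prop) fun q hq => ?_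
      have hq' := hmem q hq
      have hge : τ ≤ q.2 := by linarith
      exact ⟨hge, (mem_closedBall_horo (by simpa) (hτ.trans_le hge)).2 (hh ▸ hq')⟩
    · unfold horoKernel
      refine ContinuousOn.div (by fun_prop) (by unfold horoNum horoDen; fun_prop) fun q hq => ?_
      have hq' : (1 - x) / 2 ≤ min q.2 1 := le_min (hmem q hq) (by linarith)
      exact mul_ne_zero
        (horoNum_sub_ofReal_ne_zero hx0 hx1 ha₁ ha₁' hq' (min_le_right _ _) _)
        (horoNum_sub_ofReal_ne_zero hx0 hx1 ha₂ ha₂' hq' (min_le_right _ _) _)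
  have hgc := h.continuousOn_ext₁ hx0
  have hid : ∀ b : ℝ, 0 < b →
      2 * I * ((∫ T in (x ^ 2)..B, G₁ √T x * (b / ((T - a₁) ^ 2 + b ^ 2) : ℝ)) -
        ∫ T in (x ^ 2)..B, G₁ √T x * (b / ((T - a₂) ^ 2 + b ^ 2) : ℝ)) = L b - L (-b) := by
    intro b hb
    have e1 := h.integral_eq (σ := 1) (t₁ := a₁ + b * I) (t₂ := a₂ + b * I) (by norm_num)
      (by simpa) (by simpa) hx0 hx
    have e2 := h.integral_eq (σ := -1) (t₁ := a₁ + (-b : ℝ) * I) (t₂ := a₂ + (-b : ℝ) * I)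
      (by norm_num) (by simpa) (by simpa) hx0 hx
    rw [hs, hh] at e1 e2
    simp only [L]
    rw [← e1, ← e2]
    have hintegrable : ∀ {k : ℝ → ℂ}, Continuous k →
        IntervalIntegrable (fun T : ℝ => G₁ √T x * k T) volume (x ^ 2) B := fun hk => by
      apply ContinuousOn.intervalIntegrable
      rw [uIcc_of_le hxB]
      exact (hgc.mono Icc_subset_Ici_self).mul hk.continuousOn
    have hpk : ∀ a : ℝ, Continuous (fun T : ℝ => ((b / ((T - a) ^ 2 + b ^ 2) : ℝ) : ℂ)) := fun a =>
      continuous_ofReal.comp (Continuous.div (by fun_prop) (by fun_prop) fun T => by positivity)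
    have hsk : ∀ (σ c : ℝ), 0 < σ * c → Continuous (sqKernel (a₁ + c * I) (a₂ + c * I)) :=
      fun σ c hc => by
        unfold sqKernel
        exact Continuous.div (by fun_prop) (by fun_prop) fun T => mul_ne_zero
          (ofReal_sub_ne_zero (σ := σ) (by simpa) T) (ofReal_sub_ne_zero (σ := σ) (by simpa) T)
    rw [← intervalIntegral.integral_sub (hintegrable (hpk a₁)) (hintegrable (hpk a₂)),
      ← intervalIntegral.integral_sub (hintegrable (hsk 1 b (by simpa))) (hintegrable (hsk (-1) (-b) (by simpa))),
      ← intervalIntegral.integral_const_mul]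
    refine intervalIntegral.integral_congr fun T _ => ?_
    have := sqKernel_sub_sqKernel (a₁ := a₁) (a₂ := a₂) hb T
    linear_combination (-(G₁ √T x)) * this
  have hlim1 := ((tendsto_intervalIntegral_mul_poisson (hgc.mono Icc_subset_Ici_self) ha₁
    (by linarith : a₁ < B)).sub (tendsto_intervalIntegral_mul_poisson
      (hgc.mono Icc_subset_Ici_self) ha₂ (by linarith : a₂ < B))).const_mul (2 * I)
  have hlim2 : Tendsto (fun b => L b - L (-b)) (𝓝[>] 0) (𝓝 0) := by
    have : Continuous (fun b => L b - L (-b)) := hL.sub (hL.comp continuous_neg)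
    simpa using (this.tendsto 0).mono_left nhdsWithin_le_nhds
  have heq := tendsto_nhds_unique hlim2 (hlim1.congr' (by
    filter_upwards [self_mem_nhdsWithin] with b hb using hid b hb))
  rw [← sub_mul] at heq
  have h1 := (mul_eq_zero.1 heq.symm).resolve_left (by simp)
  exact sub_eq_zero.1 ((mul_eq_zero.1 h1).resolve_right (by exact_mod_cast Real.pi_ne_zero))

/-- The value is constant in the radius and, by continuity, tends to the value zero at radius `1`.
-/
theorem CirclePair.ext₁_eq_zero (h : CirclePair f τ G₁ G₂) {x R : ℝ} (hx0 : 0 < x)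
    (hx : x < 1 - 2 * τ) (hxR : x < R) (hR : R < 1) : G₁ R x = 0 := by
  have hτ := h.pos
  have hR0 : 0 < R := hx0.trans hxR
  have hxR2 : x ^ 2 < R ^ 2 := by nlinarith
  have hR2 : R ^ 2 < 1 := by nlinarith
  have hc : Tendsto (fun T : ℝ => G₁ √T x) (𝓝[<] 1) (𝓝 0) := by
    have h1 := (h.continuousOn_ext₁ hx0).continuousAt (Ici_mem_nhds (hxR2.trans hR2))
    have h2 := h1.tendsto.mono_left (nhdsWithin_le_nhds (s := Iio 1))
    rwa [Real.sqrt_one, h.eq_zero₁ 1 le_rfl] at h2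
  have hconst : Tendsto (fun T : ℝ => G₁ √T x) (𝓝[<] 1) (𝓝 (G₁ R x)) := by
    refine tendsto_const_nhds.congr' ?_
    filter_upwards [Ioo_mem_nhdsLT (hxR2.trans hR2)] with T hT
    have := h.ext₁_eq hx0 hx hxR2 hR2 hT.1 hT.2
    rwa [Real.sqrt_sq hR0.le] at this
  exact tendsto_nhds_unique hconst hc

theorem CirclePair.eq_zero (h : CirclePair f τ G₁ G₂) (z : ℂ) : f z = 0 := by
  have hmain : ∀ z : ℂ, z ≠ 0 → f z = 0 := by
    intro z hz
    have hz0 : 0 < ‖z‖ := norm_pos_iff.2 hz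
    obtain ⟨hc, hd, he⟩ := h.ext₁ ‖z‖ hz0
    have hfz : G₁ ‖z‖ z = f z := he (by simp)
    rcases le_or_gt 1 ‖z‖ with h1 | h1
    · rw [← hfz]; exact h.eq_zero₁ _ h1 z
    have hball : EqOn (G₁ ‖z‖) 0 (ball 0 ‖z‖) := by
      refine (hd.analyticOnNhd isOpen_ball).eqOn_zero_of_preconnected_of_frequently_eq_zero
        (convex_ball _ _).isPreconnected (mem_ball_self hz0) ?_
      -- The zeros on a real interval `(0, min ‖z‖ (1 - 2 * τ))` accumulate at the centre.
      have hlim : Tendsto (fun x : ℝ => (x : ℂ)) (𝓝[>] 0) (𝓝[≠] 0) := by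
        refine tendsto_nhdsWithin_iff.2 ⟨?_, ?_⟩
        · have := (continuous_ofReal.tendsto 0).mono_left (nhdsWithin_le_nhds (s := Ioi (0 : ℝ)))
          simpa using this
        · filter_upwards [self_mem_nhdsWithin] with x hx
          simpa using (ne_of_gt hx : x ≠ 0)
      refine hlim.frequently (Eventually.frequently ?_)
      have hτ := h.lt_half
      filter_upwards [Ioo_mem_nhdsGT (lt_min hz0 (by linarith : 0 < 1 - 2 * τ))] with x hx
      exact h.ext₁_eq_zero hx.1 (hx.2.trans_le (min_le_right _ _))
        (hx.2.trans_le (min_le_left _ _)) h1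
    rw [← hfz]
    exact hball.of_subset_closure (t := closedBall 0 ‖z‖) hc continuousOn_const
      ball_subset_closedBall (closure_ball _ hz0.ne').ge (by simp)
  have hcl : EqOn f 0 univ :=
    EqOn.of_subset_closure (s := {0}ᶜ) (fun z hz => hmain z hz)
      h.uniformContinuous.continuous.continuousOn continuousOn_const (subset_univ _)
      (dense_compl_singleton (0 : ℂ)).closure_eq.ge
  exact hcl (mem_univ z)

end

/-! ### Reduction to compactly supported functions and to `p = 1` -/

theorem ExtendsHolomorphicallyFromCircle.rotate {f : ℂ → ℂ} {p c : ℂ} {R : ℝ} (hp : ‖p‖ = 1)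
    (h : ExtendsHolomorphicallyFromCircle f (p * c) R) :
    ExtendsHolomorphicallyFromCircle (fun z => f (p * z)) c R := by
  obtain ⟨g, h1, h2, h3⟩ := h
  have hd : ∀ z, dist (p * z) (p * c) = dist z c := fun z => by
    rw [dist_eq_norm, ← mul_sub, norm_mul, hp, one_mul, dist_eq_norm]
  refine ⟨fun z => g (p * z), h1.comp (by fun_prop) fun z hz => ?_,
    h2.comp (by fun_prop) fun z hz => ?_, fun z hz => h3 ?_⟩
  · rw [mem_closedBall, hd]; exact hz
  · rw [mem_ball, hd]; exact hz
  · rw [mem_sphere, hd]; exact hz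

theorem IsHolExtension.sub_of_le {F h u : ℂ → ℂ} {c : ℂ} {r : ℝ} {g : ℂ → ℂ}
    (hg : IsHolExtension F g c r) (hh : ContinuousOn h (closedBall 0 1))
    (hh' : DifferentiableOn ℂ h (ball 0 1)) (hcr : ‖c‖ + r ≤ 1)
    (hu : EqOn u (fun z => F z - h z) (closedBall 0 1)) :
    IsHolExtension u (fun z => g z - h z) c r := by
  have h1 : closedBall c r ⊆ closedBall 0 1 := closedBall_subset_closedBall' (by
    rw [dist_zero_right]; linarith)
  have h2 : ball c r ⊆ ball 0 1 := ball_subset_ball' (by rw [dist_zero_right]; linarith)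
  refine ⟨hg.1.sub (hh.mono h1), hg.2.1.sub (hh'.mono h2), fun z hz => ?_⟩
  rw [hu (h1 (sphere_subset_closedBall hz))]
  simp only [hg.2.2 hz]

theorem holomorphic_of_extends_at_one {f : ℂ → ℂ} {τ : ℝ} (hτ0 : 0 < τ) (hτ : τ < 1 / 2)
    (hf : ContinuousOn f (closedBall 0 1))
    (h₁ : ∀ R : ℝ, 0 < R → R ≤ 1 → ExtendsHolomorphicallyFromCircle f 0 R)
    (h₂ : ∀ R : ℝ, τ ≤ R → R ≤ 1 → ExtendsHolomorphicallyFromCircle f (1 - R) R) :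
    DifferentiableOn ℂ f (ball 0 1) := by
  classical
  obtain ⟨h, hc, hd, he⟩ := h₁ 1 one_pos le_rfl
  choose! g₁ hg₁ using h₁
  choose! g₂ hg₂ using h₂
  -- `f` and `h` agree on the unit circle, so the extension by zero is continuous.
  let u : ℂ → ℂ := fun z => if ‖z‖ ≤ 1 then f z - h z else 0
  have hu1 : EqOn u (fun z => f z - h z) (closedBall 0 1) := fun z hz => by
    rw [mem_closedBall_zero_iff] at hz
    simp [u, hz]
  have hu0 : ∀ z, 1 ≤ ‖z‖ → u z = 0 := fun z hz => by
    rcases eq_or_lt_of_le hz with h0 | h0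
    · have := he (x := z) (by simp [← h0])
      simp [u, this]
    · simp [u, not_le.2 h0]
  have huc : Continuous u := by
    refine continuous_if_le continuous_norm continuous_const ?_ continuousOn_const fun z hz => ?_
    · have : {z : ℂ | ‖z‖ ≤ 1} = closedBall 0 1 := by ext z; simp
      rw [this]
      exact hf.sub hc
    · have := he (x := z) (by simp [hz])
      simp [this]
  have hucs : HasCompactSupport u := by
    refine HasCompactSupport.of_support_subset_isCompact (isCompact_closedBall 0 1) fun z hz => ?_
    by_contra hz'
    rw [mem_closedBall_zero_iff, not_le] at hz'
    exact hz (hu0 z hz'.le)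
  have hzero : ∀ (c : ℂ) (R : ℝ), (∀ z ∈ sphere c R, 1 ≤ ‖z‖) → IsHolExtension u 0 c R :=
    fun c R hR => ⟨continuousOn_const, differentiableOn_const 0, fun z hz => (hu0 z (hR z hz)).symm⟩
  have pair : CirclePair u τ (fun R => if R < 1 then fun z => g₁ R z - h z else 0)
      (fun R => if R < 1 then fun z => g₂ R z - h z else 0) := by
    refine ⟨hucs.uniformContinuous_of_continuous huc, hτ0, hτ, fun R hR => ?_, fun R hR => ?_,
      fun R hR z => ?_, fun R hR z => ?_⟩
    · rcases lt_or_ge R 1 with hR1 | hR1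
      · rw [if_pos hR1]
        exact IsHolExtension.sub_of_le (hg₁ R hR hR1.le) hc hd (by simpa using hR1.le) hu1
      · rw [if_neg (not_lt.2 hR1)]
        refine hzero _ _ fun z hz => ?_
        rw [mem_sphere_zero_iff_norm] at hz
        rwa [hz]
    · have hnorm : ‖(1 - R : ℂ)‖ = |1 - R| := by
        rw [← Real.norm_eq_abs, ← norm_real]; push_cast; rfl
      rcases lt_or_ge R 1 with hR1 | hR1
      · rw [if_pos hR1]
        refine IsHolExtension.sub_of_le (hg₂ R hR hR1.le) hc hd ?_ hu1
        rw [hnorm, abs_of_pos (by linarith)]; linarith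
      · rw [if_neg (not_lt.2 hR1)]
        -- For `R ≥ 1` the disc of radius `R` tangent at `1` contains the unit disc, so its boundary
        -- circle lies in `1 ≤ ‖z‖`.
        refine hzero _ _ fun z hz => ?_
        rw [mem_sphere, dist_eq_norm] at hz
        have := norm_sub_le z (1 - R : ℂ)
        rw [hz, hnorm, abs_of_nonpos (by linarith)] at this
        linarith
    · simp [not_lt.2 hR]
    · simp [not_lt.2 hR]
  refine hd.congr fun z hz => ?_
  have h0 := pair.eq_zero z
  rw [hu1 (ball_subset_closedBall hz)] at h0
  exact sub_eq_zero.1 h0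

theorem holomorphic_of_extends {p : ℂ} (hp : ‖p‖ = 1) {τ : ℝ} (hτ : τ < 1 / 2) {f : ℂ → ℂ}
    (hf : ContinuousOn f (closedBall 0 1))
    (h₁ : ∀ R : ℝ, 0 < R → R ≤ 1 → ExtendsHolomorphicallyFromCircle f 0 R)
    (h₂ : ∀ (c : ℂ) (R : ℝ), 0 < R → τ ≤ R → sphere c R ⊆ closedBall 0 1 → p ∈ sphere c R →
      ExtendsHolomorphicallyFromCircle f c R) :
    DifferentiableOn ℂ f (ball 0 1) := by
  have hp0 : p ≠ 0 := fun h => by simp [h] at hp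
  have key : DifferentiableOn ℂ (fun z => f (p * z)) (ball 0 1) := by
    -- Raising `τ` only discards circles; `1 / 4` stands for any number in `(0, 1/2)`.
    refine holomorphic_of_extends_at_one (τ := max τ (1 / 4)) (by positivity)
      (max_lt hτ (by norm_num)) ?_ (fun R hR hR1 => ?_) fun R hR hR1 => ?_
    · refine hf.comp (by fun_prop) fun z hz => ?_
      simpa [hp] using hz
    · refine ExtendsHolomorphicallyFromCircle.rotate hp ?_
      simpa using h₁ R hR hR1
    · have hR0 : 0 < R := lt_of_lt_of_le (by positivity) hR
      have hnorm : ‖(1 - R : ℂ)‖ = 1 - R := by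
        rw [← Real.norm_of_nonneg (sub_nonneg.2 hR1), ← norm_real]; push_cast; rfl
      refine ExtendsHolomorphicallyFromCircle.rotate hp
        (h₂ _ R hR0 ((le_max_left _ _).trans hR) ?_ ?_)
      · refine sphere_subset_closedBall.trans (closedBall_subset_closedBall' ?_)
        rw [dist_zero_right, norm_mul, hp, hnorm]; linarith
      · rw [mem_sphere, dist_eq_norm]
        have : p - p * (1 - R) = p * R := by ring
        rw [this, norm_mul, hp, norm_real, Real.norm_of_nonneg hR0.le, one_mul]
  have h3 : f = (fun z => f (p * z)) ∘ fun z => p⁻¹ * z := by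
    ext z; simp [mul_inv_cancel_left₀ hp0]
  rw [h3]
  refine key.comp (by fun_prop) fun z hz => ?_
  simpa [hp] using hz

theorem theorem1p1 (p : ℂ) (hp : ‖p‖ = 1) :
    (∀ τ : ℝ, τ < 1 / 2 → ∀ f : ℂ → ℂ,
      ContinuousOn f (Metric.closedBall 0 1) →
      (∀ R : ℝ, 0 < R → R ≤ 1 → ExtendsHolomorphicallyFromCircle f 0 R) →
      (∀ (c : ℂ) (R : ℝ), 0 < R → τ ≤ R →
        Metric.sphere c R ⊆ Metric.closedBall 0 1 → p ∈ Metric.sphere c R →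
        ExtendsHolomorphicallyFromCircle f c R) →
      DifferentiableOn ℂ f (Metric.ball 0 1)) ∧
    (∀ f : ℂ → ℂ,
      ContinuousOn f (Metric.closedBall 0 1) →
      (∀ R : ℝ, 0 < R → R ≤ 1 → ExtendsHolomorphicallyFromCircle f 0 R) →
      (∀ (c : ℂ) (R : ℝ), 0 < R →
        Metric.sphere c R ⊆ Metric.closedBall 0 1 → p ∈ Metric.sphere c R →
        ExtendsHolomorphicallyFromCircle f c R) →
      DifferentiableOn ℂ f (Metric.ball 0 1)) :=
  ⟨fun _ hτ _ hf h₁ h₂ => holomorphic_of_extends hp hτ hf h₁ h₂,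
    fun _ hf h₁ h₂ => holomorphic_of_extends hp (τ := 0) (by norm_num) hf h₁
      fun c R hR _ => h₂ c R hR⟩
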